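/- Let $G$ be a connected Lie group. All manifolds and maps are of class $C^\infty$. Let $SO(2)$ act on the unit sphere $S^2\subset\mathbf R^3$ by rotations of the first two coordinates, so that it fixes the poles $(0,0,\pm1)$. An $SO(2)$-equivariant principal $G$-bundle $\xi$ over $S^2$ is a smooth (locally trivial) principal $G$-bundle $p\colon E\to S^2$, with free right action of $G$ on $E$, denoted $\xi^\flat$, together with a smooth left action of $SO(2)$ on $E$ that commutes with the action of $G$ and for which $p$ is $SO(2)$-equivariant. Two of them are isomorphic if there is an $SO(2)$- and $G$-equivariant diffeomorphism of their total spaces over the identity of $S^2$; let $\mathcal E(2,G)$ be the set of isomorphism classes. Let $\mathcal R(2,G)$ be the set of smooth homomorphisms $SO(2)\to G$ modulo conjugation by elements of $G$. Given $\xi$, choose $a,b\in E$ with $p(a)=(0,0,-1)$ and $p(b)=(0,0,1)$, and let $\alpha,\beta\colon SO(2)\to G$ be defined by $A\cdot a=a\cdot\alpha(A)$ and $A\cdot b=b\cdot\beta(A)$. These are smooth homomorphisms whose classes in $\mathcal R(2,G)$ depend only on the isomorphism class of $\xi$, and $J\colon\mathcal E(2,G)\to\mathcal R(2,G)\times\mathcal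 R(2,G)$ is defined by $J(\xi)=([\alpha],[\beta])$. For a principal $G$-bundle $\eta$ over $S^2$ let $C(\eta)=\partial[\mathrm{id}_{S^2}]\in\pi_1(G,1)$, where $\partial\colon\pi_2(S^2)\to\pi_1(G)$ is the boundary operator of the homotopy exact sequence of $\eta$. Explicitly: if $a\in E$ lies over $(0,0,-1)$ and $F\colon D^2\to E$ is a continuous lift, with $F(1)=a$, of the map $D^2\to S^2$, $w\mapsto(2\sqrt{1-|w|^2}\,w,\,1-2|w|^2)$ (with $D^2\subset\mathbf C=\mathbf R^2$, which collapses $\partial D^2$ to the south pole), then $F(z)=a\cdot g(z)$ for $z\in S^1$, and $C(\eta)=[g]$. For smooth homomorphisms $\alpha,\beta\colon SO(2)\to G$ let $\psi(\alpha,\beta)\in\pi_1(G,1)$ be the class of the loop $z\mapsto\alpha(z)\beta(z)^{-1}$, $z\in S^1\cong SO(2)$. Then: (i) the map $J\colon\mathcal E(2,G)\to\mathcal R(2,G)\times\mathcal R(2,G)$ is a bijection; (ii) if $J(\xi)=([\alpha],[\beta])$, then $C(\xi^\flat)$ is well defined (such a lift $F$ exists, and $[g]$ depends neither on $F$ nor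 on $a$) and $C(\xi^\flat)=\psi(\alpha,\beta)$ in $\pi_1(G,1)$. -/

import Mathlib

open scoped Manifold ContDiff EuclideanGeometry

noncomputable section

namespace EquivariantBundle

/-- The matrix group `SO(2)`. -/
abbrev SO2 : Type := Matrix.specialOrthogonalGroup (Fin 2) ℝ

/-- Rotation by the angle of a unit complex number. -/
def rot (z : Circle) : SO2 :=
  ⟨!![(z : ℂ).re, -(z : ℂ).im; (z : ℂ).im, (z : ℂ).re], by
    have h : (z : ℂ).re * (z : ℂ).re + (z : ℂ).im * (z : ℂ).im = 1 := by
      rw [← Complex.normSq_apply, Circle.normSq_coe]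
    rw [Matrix.of_mem_specialOrthogonalGroup_fin_two_iff]
    refine ⟨rfl, rfl, ?_⟩
    nlinarith⟩

theorem SO2.entries (A : SO2) : A.1 0 0 = A.1 1 1 ∧ A.1 0 1 = -A.1 1 0 ∧
    A.1 0 0 ^ 2 + A.1 1 0 ^ 2 = 1 := by
  obtain ⟨h1, h2, h3⟩ := Matrix.mem_specialOrthogonalGroup_fin_two_iff.1 A.2
  exact ⟨h1, h2, by rw [h2] at h3; linarith [neg_sq (A.1 1 0)]⟩

/-- The identification of `SO(2)` with the unit circle, as groups and as topological spaces. -/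
def rotEquiv : Circle ≃* SO2 where
  toFun := rot
  invFun A := ⟨⟨A.1 0 0, A.1 1 0⟩, by
    rw [Submonoid.unitSphere, ← SetLike.mem_coe]
    simp only [Submonoid.coe_set_mk, Subsemigroup.coe_set_mk, mem_sphere_zero_iff_norm]
    rw [← sq_eq_sq₀ (norm_nonneg _) zero_le_one, ← Complex.normSq_eq_norm_sq, Complex.normSq_mk]
    linarith [A.entries.2.2, sq (A.1 0 0), sq (A.1 1 0)]⟩
  left_inv z := by ext; simp [rot]
  right_inv A := by
    obtain ⟨h1, h2, -⟩ := A.entries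
    apply Subtype.ext
    ext i j
    fin_cases i <;> fin_cases j <;> simp [rot, h1, h2]
  map_mul' z w := by
    apply Subtype.ext
    ext i j
    fin_cases i <;> fin_cases j <;> simp [rot] <;> ring

def rotHomeo : Circle ≃ₜ SO2 where
  toEquiv := rotEquiv.toEquiv
  continuous_toFun := by
    refine Continuous.subtype_mk ?_ _
    refine continuous_matrix fun i j => ?_
    fin_cases i <;> fin_cases j <;> simp <;> fun_prop
  continuous_invFun := by
    refine Continuous.subtype_mk ?_ _
    have h : ∀ i j, Continuous fun A : SO2 => A.1 i j := fun i j =>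
      continuous_subtype_val.matrix_elem i j
    exact Complex.equivRealProdCLM.symm.continuous.comp ((h 0 0).prodMk (h 1 0))

instance : ChartedSpace (EuclideanSpace ℝ (Fin 1)) SO2 where
  atlas := (rotHomeo.symm.toOpenPartialHomeomorph.trans ·) ''
    atlas (EuclideanSpace ℝ (Fin 1)) Circle
  chartAt A := rotHomeo.symm.toOpenPartialHomeomorph.trans
    (chartAt (EuclideanSpace ℝ (Fin 1)) (rotHomeo.symm A))
  mem_chart_source A := by simp
  chart_mem_atlas A := ⟨_, chart_mem_atlas _ _, rfl⟩

instance : IsManifold (𝓡 1) ∞ SO2 := by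
  refine { compatible := ?_ }
  rintro _ _ ⟨e, he, rfl⟩ ⟨e', he', rfl⟩
  have h : (rotHomeo.symm.toOpenPartialHomeomorph.trans e).symm.trans
      (rotHomeo.symm.toOpenPartialHomeomorph.trans e') = e.symm.trans e' := by
    ext x <;> simp
  simp only
  rw [h]
  exact HasGroupoid.compatible he he'

theorem chartAt_SO2 (A : SO2) : chartAt (EuclideanSpace ℝ (Fin 1)) A =
    rotHomeo.symm.toOpenPartialHomeomorph.trans
      (chartAt (EuclideanSpace ℝ (Fin 1)) (rotHomeo.symm A)) := rfl

theorem contMDiff_rotHomeo : ContMDiff (𝓡 1) (𝓡 1) ∞ rotHomeo := by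
  intro z
  rw [contMDiffAt_iff]
  refine ⟨rotHomeo.continuous.continuousAt, ?_⟩
  have := (contMDiffAt_iff.1 (contMDiffAt_id (I := 𝓡 1) (n := ∞) (x := z))).2
  convert this using 1
  ext1 x
  simp [extChartAt, chartAt_SO2]

theorem contMDiff_rotHomeo_symm : ContMDiff (𝓡 1) (𝓡 1) ∞ rotHomeo.symm := by
  intro A
  rw [contMDiffAt_iff]
  refine ⟨rotHomeo.symm.continuous.continuousAt, ?_⟩
  have := (contMDiffAt_iff.1 (contMDiffAt_id (I := 𝓡 1) (n := ∞) (x := rotHomeo.symm A))).2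
  convert this using 1
  · ext1 x
    simp [extChartAt, chartAt_SO2]
  · simp [extChartAt, chartAt_SO2]

instance : LieGroup (𝓡 1) ∞ SO2 where
  contMDiff_mul := by
    have h : ContMDiff ((𝓡 1).prod (𝓡 1)) (𝓡 1) ∞ fun p : SO2 × SO2 =>
        rotHomeo (rotHomeo.symm p.1 * rotHomeo.symm p.2) :=
      contMDiff_rotHomeo.comp ((contMDiff_rotHomeo_symm.comp contMDiff_fst).mul
        (contMDiff_rotHomeo_symm.comp contMDiff_snd))
    convert h using 2 with p
    rw [show rotHomeo (rotHomeo.symm p.1 * rotHomeo.symm p.2) =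
      rotHomeo (rotHomeo.symm p.1) * rotHomeo (rotHomeo.symm p.2) from rotEquiv.map_mul _ _]
    simp
  contMDiff_inv := by
    have h : ContMDiff (𝓡 1) (𝓡 1) ∞ fun p : SO2 => rotHomeo (rotHomeo.symm p)⁻¹ :=
      contMDiff_rotHomeo.comp contMDiff_rotHomeo_symm.inv
    convert h using 2 with p
    rw [show rotHomeo (rotHomeo.symm p)⁻¹ = (rotHomeo (rotHomeo.symm p))⁻¹ from
      map_inv rotEquiv _]
    simp

/-- The unit sphere of `ℝ³`. -/
abbrev S2 : Type := Metric.sphere (0 : EuclideanSpace ℝ (Fin 3)) 1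

theorem mem_S2 {a b c : ℝ} (h : a ^ 2 + b ^ 2 + c ^ 2 = 1) :
    !₂[a, b, c] ∈ Metric.sphere (0 : EuclideanSpace ℝ (Fin 3)) 1 := by
  rw [mem_sphere_zero_iff_norm, EuclideanSpace.norm_eq, Real.sqrt_eq_one, Fin.sum_univ_three]
  simpa using h

theorem S2.sq_sum (x : S2) : x.1 0 ^ 2 + x.1 1 ^ 2 + x.1 2 ^ 2 = 1 := by
  have h := mem_sphere_zero_iff_norm.1 x.2
  rw [EuclideanSpace.norm_eq, Real.sqrt_eq_one, Fin.sum_univ_three] at h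
  simpa using h

/-- The pole `(0, 0, -1)`. -/
def southPole : S2 := ⟨!₂[0, 0, -1], mem_S2 (by norm_num)⟩

/-- The pole `(0, 0, 1)`. -/
def northPole : S2 := ⟨!₂[0, 0, 1], mem_S2 (by norm_num)⟩

/-- The action of `SO(2)` on the sphere by rotations fixing the two poles: `A` acts on the first
two coordinates. -/
def rotate (A : SO2) (x : S2) : S2 :=
  ⟨!₂[A.1 0 0 * x.1 0 + A.1 0 1 * x.1 1, A.1 1 0 * x.1 0 + A.1 1 1 * x.1 1, x.1 2], mem_S2 (by
    obtain ⟨h1, h2, h3⟩ := A.entries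
    rw [← h1, h2]
    linear_combination (x.1 0 ^ 2 + x.1 1 ^ 2) * h3 + x.sq_sum)⟩

theorem rotate_southPole (A : SO2) : rotate A southPole = southPole := by
  apply Subtype.ext; ext i; fin_cases i <;> simp [rotate, southPole]

theorem rotate_northPole (A : SO2) : rotate A northPole = northPole := by
  apply Subtype.ext; ext i; fin_cases i <;> simp [rotate, northPole]

universe u v

section Bundles

/-- The model with corners of the total space of a bundle over `S²` whose fibre is a manifold
modelled on `V`. -/
abbrev totalModel (V : Type v) [NormedAddCommGroup V] [NormedSpace ℝ V] :
    ModelWithCorners ℝ (EuclideanSpace ℝ (Fin 2) × V) (ModelProd (EuclideanSpace ℝ (Fin 2)) V) :=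
  (𝓡 2).prod 𝓘(ℝ, V)

/-- A smooth principal `G`-bundle over `S²`. -/
structure PrincipalBundle (V : Type v) [NormedAddCommGroup V] [NormedSpace ℝ V]
    (G : Type u) [Group G] [TopologicalSpace G] [ChartedSpace V G] where
  E : Type u
  [topE : TopologicalSpace E]
  [t2E : T2Space E]
  [scE : SecondCountableTopology E]
  [chartedE : ChartedSpace (ModelProd (EuclideanSpace ℝ (Fin 2)) V) E]
  [manifoldE : IsManifold (totalModel V) ∞ E]
  proj : E → S2
  proj_smooth : ContMDiff (totalModel V) (𝓡 2) ∞ proj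
  /-- The right action of `G`. -/
  act : E → G → E
  act_one : ∀ z, act z 1 = z
  act_mul : ∀ z g h, act z (g * h) = act (act z g) h
  act_free : ∀ z g, act z g = z → g = 1
  act_smooth : ContMDiff ((totalModel V).prod 𝓘(ℝ, V)) (totalModel V) ∞
    fun q : E × G => act q.1 q.2
  proj_act : ∀ z g, proj (act z g) = proj z
  /-- Every point of the base has an open neighbourhood `U` and a `G`-equivariant diffeomorphism
  of `proj⁻¹(U)` with `U × G` over `U`. -/
  locally_trivial : ∀ x : S2, ∃ e : Bundle.Trivialization G proj, x ∈ e.baseSet ∧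
    ContMDiffOn (totalModel V) ((𝓡 2).prod 𝓘(ℝ, V)) ∞ e e.source ∧
    ContMDiffOn ((𝓡 2).prod 𝓘(ℝ, V)) (totalModel V) ∞ e.toOpenPartialHomeomorph.symm e.target ∧
    ∀ z ∈ e.source, ∀ g, e (act z g) = ((e z).1, (e z).2 * g)

attribute [instance] PrincipalBundle.topE PrincipalBundle.t2E PrincipalBundle.scE
  PrincipalBundle.chartedE PrincipalBundle.manifoldE

/-- An `SO(2)`-equivariant smooth principal `G`-bundle over `S²`. -/
structure EquivariantPrincipalBundle (V : Type v) [NormedAddCommGroup V] [NormedSpace ℝ V]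
    (G : Type u) [Group G] [TopologicalSpace G] [ChartedSpace V G]
    extends PrincipalBundle V G where
  /-- The left action of `SO(2)`. -/
  rotAct : SO2 → E → E
  rotAct_one : ∀ z, rotAct 1 z = z
  rotAct_mul : ∀ A B z, rotAct (A * B) z = rotAct A (rotAct B z)
  rotAct_smooth : ContMDiff ((𝓡 1).prod (totalModel V)) (totalModel V) ∞
    fun q : SO2 × E => rotAct q.1 q.2
  rotAct_act : ∀ A z g, rotAct A (act z g) = act (rotAct A z) g
  proj_rotAct : ∀ A z, proj (rotAct A z) = rotate A (proj z)

variable {V : Type v} [NormedAddCommGroup V] [NormedSpace ℝ V]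
  {G : Type u} [Group G] [TopologicalSpace G] [ChartedSpace V G]

/-- Isomorphism of equivariant bundles: an `SO(2)`- and `G`-equivariant diffeomorphism over the
identity of `S²`. -/
def Isomorphic (ξ ξ' : EquivariantPrincipalBundle V G) : Prop :=
  ∃ h : Diffeomorph (totalModel V) (totalModel V) ξ.E ξ'.E ∞,
    (∀ z g, h (ξ.act z g) = ξ'.act (h z) g) ∧
    (∀ A z, h (ξ.rotAct A z) = ξ'.rotAct A (h z)) ∧
    ∀ z, ξ'.proj (h z) = ξ.proj z

variable (V G) in
instance isoSetoid : Setoid (EquivariantPrincipalBundle V G) where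
  r := Isomorphic
  iseqv :=
    { refl := fun ξ => ⟨Diffeomorph.refl _ _ _, fun _ _ => rfl, fun _ _ => rfl, fun _ => rfl⟩
      symm := by
        rintro ξ ξ' ⟨h, h1, h2, h3⟩
        refine ⟨h.symm, fun z g => ?_, fun A z => ?_, fun z => ?_⟩
        · refine h.injective (?_ : h _ = h _)
          rw [h1, h.apply_symm_apply, h.apply_symm_apply]
        · refine h.injective (?_ : h _ = h _)
          rw [h2, h.apply_symm_apply, h.apply_symm_apply]
        · rw [← h3, h.apply_symm_apply]
      trans := by
        rintro ξ ξ' ξ'' ⟨h, h1, h2, h3⟩ ⟨k, k1, k2, k3⟩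
        refine ⟨h.trans k, fun z g => ?_, fun A z => ?_, fun z => ?_⟩
        · simp [h1, k1]
        · simp [h2, k2]
        · simp [h3, k3] }

variable (V G) in
/-- The set of isomorphism classes of `SO(2)`-equivariant principal `G`-bundles over `S²`. -/
def BundleClasses : Type _ := Quotient (isoSetoid V G)

variable (V G) in
/-- Smooth homomorphisms `SO(2) → G`. -/
abbrev SmoothHom : Type _ := ContMDiffMonoidMorphism (𝓡 1) 𝓘(ℝ, V) ∞ SO2 G

variable (V G) in
/-- Two smooth homomorphisms `SO(2) → G` are equivalent if they are conjugate by an element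
of `G`. -/
instance conjSetoid : Setoid (SmoothHom V G) where
  r α β := ∃ g : G, ∀ A, β A = g * α A * g⁻¹
  iseqv :=
    { refl := fun α => ⟨1, fun A => by simp⟩
      symm := by
        rintro α β ⟨g, h⟩
        exact ⟨g⁻¹, fun A => by rw [h]; group⟩
      trans := by
        rintro α β γ ⟨g, h⟩ ⟨k, h'⟩
        exact ⟨k * g, fun A => by rw [h', h]; group⟩ }

variable (V G) in
/-- The set of conjugacy classes of smooth homomorphisms `SO(2) → G`. -/
def RepClasses : Type _ := Quotient (conjSetoid V G)

namespace PrincipalBundle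

variable (η : PrincipalBundle V G)

theorem exists_point (x : S2) : ∃ a : η.E, η.proj a = x := by
  obtain ⟨e, hx, -⟩ := η.locally_trivial x
  exact ⟨e.toOpenPartialHomeomorph.symm (x, 1), e.proj_symm_apply' hx⟩

theorem act_left_cancel {z : η.E} {g h : G} (H : η.act z g = η.act z h) : g = h := by
  have : η.act z (g * h⁻¹) = z := by rw [η.act_mul, H, ← η.act_mul, mul_inv_cancel, η.act_one]
  exact mul_inv_eq_one.1 (η.act_free _ _ this)

theorem exists_act_eq {z w : η.E} (H : η.proj w = η.proj z) : ∃ g, w = η.act z g := by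
  obtain ⟨e, hx, -, -, he⟩ := η.locally_trivial (η.proj z)
  have hz : z ∈ e.source := e.mem_source.2 hx
  have hw : w ∈ e.source := e.mem_source.2 (H ▸ hx)
  have hzg : η.act z ((e z).2⁻¹ * (e w).2) ∈ e.source :=
    e.mem_source.2 ((η.proj_act _ _).symm ▸ hx)
  refine ⟨(e z).2⁻¹ * (e w).2, e.injOn hw hzg (?_ : e _ = e _)⟩
  rw [he z hz]
  ext1
  · simp [e.coe_fst hz, e.coe_fst hw, H]
  · simp

end PrincipalBundle

namespace EquivariantPrincipalBundle

variable (ξ : EquivariantPrincipalBundle V G)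

theorem exists_rep {a : ξ.E} (ha : ∀ A, rotate A (ξ.proj a) = ξ.proj a) (A : SO2) :
    ∃ g, ξ.rotAct A a = ξ.act a g :=
  ξ.exists_act_eq (by rw [ξ.proj_rotAct, ha])

theorem contMDiff_of_rep [LieGroup 𝓘(ℝ, V) ∞ G] {a : ξ.E}
    (ha : ∀ A, rotate A (ξ.proj a) = ξ.proj a)
    {α : SO2 → G} (hα : ∀ A, ξ.rotAct A a = ξ.act a (α A)) :
    ContMDiff (𝓡 1) 𝓘(ℝ, V) ∞ α := by
  obtain ⟨e, hx, he1, -, he⟩ := ξ.locally_trivial (ξ.proj a)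
  have hs : ∀ A, ξ.rotAct A a ∈ e.source := fun A =>
    e.mem_source.2 (by rw [ξ.proj_rotAct, ha]; exact hx)
  have h1 : ContMDiff (𝓡 1) (totalModel V) ∞ fun A => ξ.rotAct A a :=
    ξ.rotAct_smooth.comp (contMDiff_id.prodMk contMDiff_const)
  have h2 : ContMDiff (𝓡 1) 𝓘(ℝ, V) ∞ fun A => (e (ξ.rotAct A a)).2 :=
    contMDiff_snd.comp (he1.comp_contMDiff h1 hs)
  have h3 : α = fun A => (e a).2⁻¹ * (e (ξ.rotAct A a)).2 := by
    funext A
    rw [hα, he a (e.mem_source.2 hx)]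
    simp
  rw [h3]
  exact contMDiff_const.mul h2

/-- The isotropy representation `α` at a point `a` above a fixed point of the rotations:
`A · a = a · α(A)`. -/
def isotropyRep [LieGroup 𝓘(ℝ, V) ∞ G] (a : ξ.E)
    (ha : ∀ A, rotate A (ξ.proj a) = ξ.proj a) : SmoothHom V G where
  toFun A := (ξ.exists_rep ha A).choose
  map_one' := by
    apply ξ.act_left_cancel (z := a)
    rw [← (ξ.exists_rep ha 1).choose_spec, ξ.rotAct_one, ξ.act_one]
  map_mul' A B := by
    apply ξ.act_left_cancel (z := a)
    have hB := congrArg (ξ.rotAct A) (ξ.exists_rep ha B).choose_spec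
    rw [← (ξ.exists_rep ha (A * B)).choose_spec, ξ.rotAct_mul, hB, ξ.rotAct_act, ξ.act_mul,
      ← (ξ.exists_rep ha A).choose_spec]
  contMDiff_toFun := ξ.contMDiff_of_rep ha fun A => (ξ.exists_rep ha A).choose_spec

theorem isotropyRep_spec [LieGroup 𝓘(ℝ, V) ∞ G] (a : ξ.E)
    (ha : ∀ A, rotate A (ξ.proj a) = ξ.proj a) (A : SO2) :
    ξ.rotAct A a = ξ.act a (ξ.isotropyRep a ha A) :=
  (ξ.exists_rep ha A).choose_spec

/-- The class of the isotropy representation at (any point above) a fixed point `x`. -/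
def isotropyClass [LieGroup 𝓘(ℝ, V) ∞ G] (x : S2) (hx : ∀ A, rotate A x = x) :
    RepClasses V G :=
  Quotient.mk _ (ξ.isotropyRep (ξ.exists_point x).choose
    (by rw [(ξ.exists_point x).choose_spec]; exact hx))

theorem isotropyClass_eq [LieGroup 𝓘(ℝ, V) ∞ G] (x : S2) (hx : ∀ A, rotate A x = x)
    (a : ξ.E) (ha : ξ.proj a = x) (α : SmoothHom V G)
    (hα : ∀ A, ξ.rotAct A a = ξ.act a (α A)) :
    ξ.isotropyClass x hx = Quotient.mk _ α := by
  apply Quotient.sound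
  set b := (ξ.exists_point x).choose with hb
  have hbx : ξ.proj b = x := (ξ.exists_point x).choose_spec
  obtain ⟨g, hg⟩ := ξ.exists_act_eq (hbx.trans ha.symm)
  refine ⟨g, fun A => ?_⟩
  have h := ξ.isotropyRep_spec b (by rw [hbx]; exact hx) A
  have h' : α A * g = g * ξ.isotropyRep b (by rw [hbx]; exact hx) A := by
    apply ξ.act_left_cancel (z := a)
    rw [ξ.act_mul, ← hα, ← ξ.rotAct_act, ← hg, h, ξ.act_mul, ← hg]
  exact eq_mul_inv_of_mul_eq h'

end EquivariantPrincipalBundle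

theorem isotropyClass_congr [LieGroup 𝓘(ℝ, V) ∞ G] {ξ ξ' : EquivariantPrincipalBundle V G}
    (H : Isomorphic ξ ξ') (x : S2) (hx : ∀ A, rotate A x = x) :
    ξ.isotropyClass x hx = ξ'.isotropyClass x hx := by
  obtain ⟨h, h1, h2, h3⟩ := H
  obtain ⟨a, ha⟩ := ξ.exists_point x
  have hax : ∀ A, rotate A (ξ.proj a) = ξ.proj a := by rw [ha]; exact hx
  rw [ξ.isotropyClass_eq x hx a ha _ (ξ.isotropyRep_spec a hax),
    ξ'.isotropyClass_eq x hx (h a) ((h3 a).trans ha) (ξ.isotropyRep a hax)]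
  intro A
  rw [← h2, ξ.isotropyRep_spec a hax, h1]

/-- The map `J`, sending the class of `ξ` to the classes of its isotropy representations at the
south pole and at the north pole, in this order. -/
def J [LieGroup 𝓘(ℝ, V) ∞ G] : BundleClasses V G → RepClasses V G × RepClasses V G :=
  Quotient.lift
    (fun ξ => (ξ.isotropyClass southPole rotate_southPole,
      ξ.isotropyClass northPole rotate_northPole))
    fun _ _ H => Prod.ext (isotropyClass_congr H _ rotate_southPole)
      (isotropyClass_congr H _ rotate_northPole)

/-- The standard parametrization `t ↦ exp(2πit)` of the circle. -/
def circleLoop (t : unitInterval) : Circle := Circle.exp (2 * Real.pi * t)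

theorem continuous_circleLoop : Continuous circleLoop := by
  unfold circleLoop; fun_prop

/-- The loop `z ↦ α(z) β(z)⁻¹` in `G`, where `z` runs through `S¹ ≅ SO(2)`. -/
def psiLoop [LieGroup 𝓘(ℝ, V) ∞ G] (α β : SmoothHom V G) : Path (1 : G) 1 where
  toFun t := α (rot (circleLoop t)) * (β (rot (circleLoop t)))⁻¹
  continuous_toFun :=
    haveI := topologicalGroup_of_lieGroup 𝓘(ℝ, V) ∞ (G := G)
    have h : Continuous fun t => rot (circleLoop t) :=
      rotHomeo.continuous.comp continuous_circleLoop
    ((map_continuous α).comp h).mul ((map_continuous β).comp h).inv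
  source' := by
    have h : rot (circleLoop 0) = 1 := by
      rw [show circleLoop 0 = 1 by simp [circleLoop]]; exact map_one rotEquiv
    rw [h, map_one, map_one, inv_one, mul_one]
  target' := by
    have h : rot (circleLoop 1) = 1 := by
      rw [show circleLoop 1 = 1 by simp [circleLoop]]; exact map_one rotEquiv
    rw [h, map_one, map_one, inv_one, mul_one]

/-- `ψ(α, β) = [z ↦ α(z) β(z)⁻¹] ∈ π₁(G, 1)`. -/
def psi [LieGroup 𝓘(ℝ, V) ∞ G] (α β : SmoothHom V G) : FundamentalGroup G 1 :=
  FundamentalGroup.fromPath (Path.Homotopic.Quotient.mk (psiLoop α β))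

/-- The closed unit disc. -/
abbrev Disc : Type := Metric.closedBall (0 : ℂ) 1

/-- The boundary circle of the disc. -/
def discBoundary (z : Circle) : Disc := ⟨z, mem_closedBall_zero_iff.2 z.norm_coe.le⟩

/-- The map `D² → S²`, `w ↦ (2 √(1 - |w|²) w, 1 - 2 |w|²)`, which collapses the boundary circle to
the south pole and is an orientation preserving homeomorphism of the open disc onto the complement
of the south pole (the sphere being oriented by the outward normal). It represents the class of
`id` in `π₂(S², southPole) = π₂(D²/∂D², *)`. -/
def collapse : C(Disc, S2) where
  toFun w := ⟨!₂[2 * √(1 - ‖w.1‖ ^ 2) * w.1.re, 2 * √(1 - ‖w.1‖ ^ 2) * w.1.im,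
      1 - 2 * ‖w.1‖ ^ 2], mem_S2 (by
    have h1 : ‖w.1‖ ≤ 1 := mem_closedBall_zero_iff.1 w.2
    have h2 : √(1 - ‖w.1‖ ^ 2) ^ 2 = 1 - ‖w.1‖ ^ 2 :=
      Real.sq_sqrt (by nlinarith [norm_nonneg w.1])
    have h3 : w.1.re ^ 2 + w.1.im ^ 2 = ‖w.1‖ ^ 2 := by
      rw [← Complex.normSq_eq_norm_sq, Complex.normSq_apply]; ring
    linear_combination 4 * (w.1.re ^ 2 + w.1.im ^ 2) * h2 + 4 * (1 - ‖w.1‖ ^ 2) * h3)⟩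
  continuous_toFun := by
    refine Continuous.subtype_mk ?_ _
    refine (PiLp.continuous_toLp 2 _).comp (continuous_pi fun i => ?_)
    fin_cases i <;> simp <;> fun_prop

/-- The boundary operator `∂ : π₂(S², x₀) → π₁(G)` of the homotopy exact sequence of a principal
bundle, on the class of a map `f : (D², S¹) → (S², x₀)`: one lifts `f` to a map `F : D² → E` with
`F(1) = a`; on the boundary circle `F` takes values in the fibre `a · G ≅ G`, which gives a loop
in `G` based at `1`. The set collects the values for all `a` above `x₀`; it is an orbit of the
action of `π₀(G)` on `π₁(G)` by conjugation. -/
def PrincipalBundle.boundary (η : PrincipalBundle V G) (f : C(Disc, S2)) :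
    Set (FundamentalGroup G 1) :=
  {c | ∃ (a : η.E) (F : C(Disc, η.E)) (γ : Path (1 : G) 1),
    (∀ w, η.proj (F w) = f w) ∧
    (∀ t, F (discBoundary (circleLoop t)) = η.act a (γ t)) ∧
    c = FundamentalGroup.fromPath (Path.Homotopic.Quotient.mk γ)}

/-- The class `C(η) = [∂(id)] ∈ π₁(G) / π₀(G)`, an orbit of the conjugation action of `π₀(G)`,
regarded as a subset of `π₁(G)`. -/
def PrincipalBundle.C (η : PrincipalBundle V G) : Set (FundamentalGroup G 1) :=
  η.boundary collapse

end Bundles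

end EquivariantBundle

end

/-
Over the complement of each pole, in the stereographic coordinate centred at the other pole, a
smooth section that is equivariant up to the isotropy representation is determined by its
restriction to a meridian. Two such sections that agree on a meridian frame the bundle: away from
the poles they differ by `α(z) β(z)⁻¹`, where `z` is the angle of the base point. So bundles with
the same representations are isomorphic, and gluing the two trivial bundles along this function
realizes any pair of representations.

To construct a framing, one averages a local trivialization around each pole over the circle acting
by `p ↦ z · p · γ(z)⁻¹`, in a chart of `G` at `1`; the implicit function theorem makes the zero set
of the average an equivariant section near the pole. Its restriction to the meridian extends to a
lift of the whole meridian that has the prescribed germ at the other pole, because `G` is connected,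
and this lift is then spread over the sphere by rotations.

In polar coordinates on the disc, the section around the south pole multiplied by `α(z) β(z)⁻¹`
extends continuously over the centre, where it is the section around the north pole. It lifts the
collapse map, and its boundary loop is `ψ(α, β)`.
-/

noncomputable section

namespace EquivariantBundle

open Set Filter Topology

universe u v

/-! ### Stereographic coordinates centred at the poles -/

section Sphere

variable {F : Type*} [NormedAddCommGroup F] [NormedSpace ℝ F] {H : Type*} [TopologicalSpace H]
  {I : ModelWithCorners ℝ F H} {M : Type*} [TopologicalSpace M] [ChartedSpace H M]

theorem contMDiffOn_sphere_of_coe {E : Type*} [NormedAddCommGroup E] [InnerProductSpace ℝ E]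
    {n : ℕ} [Fact (Module.finrank ℝ E = n + 1)] [IsManifold I ∞ M] {s : Set M}
    {f : M → Metric.sphere (0 : E) 1}
    (hf : ContMDiffOn I 𝓘(ℝ, E) ∞ (fun x => (f x : E)) s) : ContMDiffOn I (𝓡 n) ∞ f s := by
  rw [contMDiffOn_iff_target]
  refine ⟨continuousOn_iff_continuous_domRestrict.2
    (continuous_induced_rng.2 (continuousOn_iff_continuous_domRestrict.1 hf.continuousOn)), ?_⟩
  intro v
  let U : _ ≃ₗᵢ[ℝ] _ :=
    (OrthonormalBasis.fromOrthogonalSpanSingleton n (ne_zero_of_mem_unit_sphere (-v))).repr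
  have hU : ContDiffOn ℝ ω _ Set.univ := U.contDiff.contDiffOn
  have h_chart := (hU.comp_inter contDiffOn_stereoToFun).contMDiffOn
  convert! (h_chart.of_le le_top).comp' hf using 1
  ext x
  have h_antipode : (f x : E) = -↑v ↔ inner ℝ (f x : E) (-(v : E)) = 1 := by
    rw [inner_eq_one_iff_of_norm_eq_one (norm_eq_of_mem_sphere (f x))]
    exact norm_eq_of_mem_sphere (-v)
  simp [chartAt, ChartedSpace.chartAt, Subtype.ext_iff, h_antipode, real_inner_comm]

theorem fact_finrank_euclideanSpace_three :
    Fact (Module.finrank ℝ (EuclideanSpace ℝ (Fin 3)) = 2 + 1) := ⟨by simp⟩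

theorem contMDiffOn_S2_of_coord [IsManifold I ∞ M] {s : Set M} {f : M → S2}
    (hf : ∀ i, ContMDiffOn I 𝓘(ℝ, ℝ) ∞ (fun x => (f x).1 i) s) : ContMDiffOn I (𝓡 2) ∞ f s := by
  have := fact_finrank_euclideanSpace_three
  apply contMDiffOn_sphere_of_coe
  have h : ContMDiffOn I 𝓘(ℝ, Fin 3 → ℝ) ∞ (fun x i => (f x).1 i) s :=
    contMDiffOn_pi_space.2 hf
  exact ((EuclideanSpace.equiv (Fin 3) ℝ).symm.contDiff.contMDiff.comp_contMDiffOn h)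

theorem contMDiff_S2_coord (i : Fin 3) : ContMDiff (𝓡 2) 𝓘(ℝ, ℝ) ∞ fun x : S2 => x.1 i :=
  haveI := fact_finrank_euclideanSpace_three
  (EuclideanSpace.proj (𝕜 := ℝ) i).contDiff.contMDiff.comp contMDiff_coe_sphere

theorem contMDiffOn_circle_of_coe [IsManifold I ∞ M] {s : Set M} {f : M → Circle}
    (hf : ContMDiffOn I 𝓘(ℝ, ℂ) ∞ (fun x => (f x : ℂ)) s) : ContMDiffOn I (𝓡 1) ∞ f s :=
  haveI := finrank_real_complex_fact'
  contMDiffOn_sphere_of_coe (E := ℂ) (n := 1) hf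

theorem contMDiff_circle_coe : ContMDiff (𝓡 1) 𝓘(ℝ, ℂ) ∞ fun z : Circle => (z : ℂ) :=
  haveI := finrank_real_complex_fact'
  contMDiff_coe_sphere (E := ℂ) (n := 1)

end Sphere

theorem contMDiff_rot : ContMDiff (𝓡 1) (𝓡 1) ∞ rot := contMDiff_rotHomeo

theorem rot_mul (z w : Circle) : rot (z * w) = rot z * rot w := rotEquiv.map_mul z w

theorem rot_one : rot 1 = 1 := map_one rotEquiv

theorem rot_surjective : Function.Surjective rot := rotEquiv.surjective

theorem contMDiff_SO2_entry (i j : Fin 2) : ContMDiff (𝓡 1) 𝓘(ℝ, ℝ) ∞ fun A : SO2 => A.1 i j := by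
  have h := contMDiff_circle_coe.comp contMDiff_rotHomeo_symm
  have hre : ContMDiff (𝓡 1) 𝓘(ℝ, ℝ) ∞ fun A : SO2 => A.1 0 0 :=
    Complex.reCLM.contDiff.contMDiff.comp h
  have him : ContMDiff (𝓡 1) 𝓘(ℝ, ℝ) ∞ fun A : SO2 => A.1 1 0 :=
    Complex.imCLM.contDiff.contMDiff.comp h
  fin_cases i <;> fin_cases j
  · exact hre
  · exact him.neg.congr fun A => A.entries.2.1
  · exact him
  · exact hre.congr fun A => A.entries.1.symm

theorem contMDiff_rotate :
    ContMDiff ((𝓡 1).prod (𝓡 2)) (𝓡 2) ∞ fun q : SO2 × S2 => rotate q.1 q.2 := by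
  rw [← contMDiffOn_univ]
  apply contMDiffOn_S2_of_coord
  have hA : ∀ i j, ContMDiff ((𝓡 1).prod (𝓡 2)) 𝓘(ℝ, ℝ) ∞ fun q : SO2 × S2 => q.1.1 i j :=
    fun i j => (contMDiff_SO2_entry i j).comp contMDiff_fst
  have hx : ∀ i, ContMDiff ((𝓡 1).prod (𝓡 2)) 𝓘(ℝ, ℝ) ∞ fun q : SO2 × S2 => q.2.1 i :=
    fun i => (contMDiff_S2_coord i).comp contMDiff_snd
  intro i
  rw [contMDiffOn_univ]
  fin_cases i
  · exact ((hA 0 0).mul (hx 0)).add ((hA 0 1).mul (hx 1))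
  · exact ((hA 1 0).mul (hx 0)).add ((hA 1 1).mul (hx 1))
  · exact hx 2

theorem rotate_one (x : S2) : rotate 1 x = x := by
  apply Subtype.ext; ext i; fin_cases i <;> simp [rotate]

theorem rotate_mul (A B : SO2) (x : S2) : rotate (A * B) x = rotate A (rotate B x) := by
  apply Subtype.ext
  ext i
  fin_cases i <;> simp [rotate, Matrix.mul_apply, Fin.sum_univ_two] <;> ring

/-- The sign `ε = ±1` as a real number; signs index the two poles, their stereographic charts and
the equivariant sections over these charts. -/
def sgn (ε : ℤˣ) : ℝ := ((ε : ℤ) : ℝ)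

theorem sgn_sq (ε : ℤˣ) : sgn ε ^ 2 = 1 := by
  rcases Int.units_eq_one_or ε with rfl | rfl <;> simp [sgn]

theorem sgn_neg (ε : ℤˣ) : sgn (-ε) = -sgn ε := by simp [sgn]

theorem sgn_one : sgn 1 = 1 := by simp [sgn]

theorem sgn_ne_zero (ε : ℤˣ) : sgn ε ≠ 0 := by
  intro h; simpa [h] using sgn_sq ε

/-- The pole `(0, 0, ε)`, so that both poles can be treated at once. -/
def pole (ε : ℤˣ) : S2 := ⟨!₂[0, 0, sgn ε], mem_S2 (by simp [sgn_sq])⟩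

theorem pole_one : pole 1 = northPole := by simp [pole, northPole, sgn]

theorem pole_neg_one : pole (-1) = southPole := by simp [pole, southPole, sgn]

theorem eq_pole_iff {x : S2} {ε : ℤˣ} : x = pole ε ↔ x.1 2 = sgn ε := by
  refine ⟨fun h => by simp [h, pole], fun h => ?_⟩
  have hsum : x.1 0 ^ 2 + x.1 1 ^ 2 + x.1 2 ^ 2 = 1 := x.sq_sum
  rw [h, sgn_sq] at hsum
  have h0 : x.1 0 = 0 := by nlinarith [sq_nonneg (x.1 0), sq_nonneg (x.1 1)]
  have h1 : x.1 1 = 0 := by nlinarith [sq_nonneg (x.1 0), sq_nonneg (x.1 1)]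
  apply Subtype.ext; ext i; fin_cases i <;> simp [pole, h0, h1, h]

theorem pole_ne_pole_neg (ε : ℤˣ) : pole ε ≠ pole (-ε) := by
  rw [Ne, eq_pole_iff, sgn_neg]
  intro h
  have h' : sgn ε = -sgn ε := by simpa [pole] using h
  exact sgn_ne_zero ε (by linarith)

/-- The inverse of the stereographic projection `coord ε`: a parametrization of the sphere minus
`pole (-ε)` by `ℂ` that sends `0` to `pole ε` and turns rotations into complex multiplication. -/
def stereo (ε : ℤˣ) (x : ℂ) : S2 :=
  ⟨!₂[2 * x.re / (1 + Complex.normSq x), 2 * x.im / (1 + Complex.normSq x),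
    sgn ε * (1 - Complex.normSq x) / (1 + Complex.normSq x)], mem_S2 (by
      have h : 1 + Complex.normSq x ≠ 0 := by linarith [Complex.normSq_nonneg x]
      have h' : Complex.normSq x = x.re ^ 2 + x.im ^ 2 := by rw [Complex.normSq_apply]; ring
      field_simp
      rw [sgn_sq, h']
      ring)⟩

/-- Stereographic projection from the pole `-ε`, with the junk value `0` at that pole. -/
def coord (ε : ℤˣ) (x : S2) : ℂ := ⟨x.1 0 / (1 + sgn ε * x.1 2), x.1 1 / (1 + sgn ε * x.1 2)⟩

theorem one_add_normSq_ne_zero (x : ℂ) : 1 + Complex.normSq x ≠ 0 := by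
  linarith [Complex.normSq_nonneg x]

theorem contDiff_normSq : ContDiff ℝ ∞ (fun x : ℂ => Complex.normSq x) := by
  simp only [Complex.normSq_apply]
  exact (Complex.reCLM.contDiff.mul Complex.reCLM.contDiff).add
    (Complex.imCLM.contDiff.mul Complex.imCLM.contDiff)

theorem contMDiff_stereo (ε : ℤˣ) : ContMDiff 𝓘(ℝ, ℂ) (𝓡 2) ∞ (stereo ε) := by
  rw [← contMDiffOn_univ]
  apply contMDiffOn_S2_of_coord
  intro i
  rw [contMDiffOn_univ]
  apply ContDiff.contMDiff
  have hd : ContDiff ℝ ∞ (fun x : ℂ => 1 + Complex.normSq x) := contDiff_const.add contDiff_normSq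
  fin_cases i
  · exact (contDiff_const.mul Complex.reCLM.contDiff).div hd one_add_normSq_ne_zero
  · exact (contDiff_const.mul Complex.imCLM.contDiff).div hd one_add_normSq_ne_zero
  · exact (contDiff_const.mul (contDiff_const.sub contDiff_normSq)).div hd one_add_normSq_ne_zero

theorem one_add_sgn_mul_ne_zero {ε : ℤˣ} {x : S2} (h : x ≠ pole (-ε)) : 1 + sgn ε * x.1 2 ≠ 0 := by
  rw [Ne, eq_pole_iff, sgn_neg] at h
  intro h'
  apply h
  linear_combination sgn ε * h' - x.1 2 * sgn_sq ε

theorem contMDiffOn_coord (ε : ℤˣ) : ContMDiffOn (𝓡 2) 𝓘(ℝ, ℂ) ∞ (coord ε) {pole (-ε)}ᶜ := by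
  have hd : ContMDiffOn (𝓡 2) 𝓘(ℝ, ℝ) ∞ (fun x : S2 => 1 + sgn ε * x.1 2) {pole (-ε)}ᶜ :=
    (contMDiff_const.add (contMDiff_const.mul (contMDiff_S2_coord 2))).contMDiffOn
  have hd' : ContMDiffOn (𝓡 2) 𝓘(ℝ, ℝ) ∞ (fun x : S2 => (1 + sgn ε * x.1 2)⁻¹) {pole (-ε)}ᶜ :=
    hd.inv₀ fun x hx => one_add_sgn_mul_ne_zero hx
  have h0 := (contMDiff_S2_coord 0).contMDiffOn.mul hd'
  have h1 := (contMDiff_S2_coord 1).contMDiffOn.mul hd'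
  have h := Complex.equivRealProdCLM.symm.contDiff (n := ∞) |>.contMDiff.comp_contMDiffOn
    (h0.prodMk_space h1)
  refine h.congr fun x _ => ?_
  apply Complex.ext <;> simp [coord, div_eq_mul_inv]

theorem coord_stereo (ε : ℤˣ) (x : ℂ) : coord ε (stereo ε x) = x := by
  have h := one_add_normSq_ne_zero x
  have h_denom : 1 + sgn ε * (sgn ε * (1 - Complex.normSq x) / (1 + Complex.normSq x)) =
      2 / (1 + Complex.normSq x) := by
    field_simp
    linear_combination (1 - Complex.normSq x) * sgn_sq ε
  apply Complex.ext <;> simp [coord, stereo, h_denom] <;> field_simp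

theorem normSq_coord {ε : ℤˣ} {x : S2} (hx : x ≠ pole (-ε)) :
    Complex.normSq (coord ε x) = (1 - sgn ε * x.1 2) / (1 + sgn ε * x.1 2) := by
  have h := one_add_sgn_mul_ne_zero hx
  simp only [coord, Complex.normSq_mk]
  field_simp
  linear_combination x.sq_sum + x.1 2 ^ 2 * sgn_sq ε

theorem stereo_coord {ε : ℤˣ} {x : S2} (hx : x ≠ pole (-ε)) : stereo ε (coord ε x) = x := by
  have h := one_add_sgn_mul_ne_zero hx
  have h_denom : 1 + Complex.normSq (coord ε x) = 2 / (1 + sgn ε * x.1 2) := by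
    rw [normSq_coord hx]; field_simp; ring
  have h_height : 1 - Complex.normSq (coord ε x) = 2 * sgn ε * x.1 2 / (1 + sgn ε * x.1 2) := by
    rw [normSq_coord hx]; field_simp; ring
  apply Subtype.ext
  ext i
  fin_cases i
  · simp only [stereo, h_denom]; simp [coord]; field_simp
  · simp only [stereo, h_denom]; simp [coord]; field_simp
  · simp only [stereo, h_denom, h_height]; simp; field_simp
    linear_combination x.1 2 * sgn_sq ε

theorem stereo_zero (ε : ℤˣ) : stereo ε 0 = pole ε := by
  simp [stereo, pole]

theorem coord_pole (ε : ℤˣ) : coord ε (pole ε) = 0 := by rw [← stereo_zero, coord_stereo]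

theorem stereo_ne_pole_neg (ε : ℤˣ) (x : ℂ) : stereo ε x ≠ pole (-ε) := by
  rw [Ne, eq_pole_iff, sgn_neg]
  intro h
  have h_height : sgn ε * (1 - Complex.normSq x) / (1 + Complex.normSq x) = -sgn ε := h
  have h_denom := one_add_normSq_ne_zero x
  field_simp at h_height
  exact sgn_ne_zero ε (by linarith)

theorem rotate_stereo (z : Circle) (ε : ℤˣ) (x : ℂ) :
    rotate (rot z) (stereo ε x) = stereo ε (z * x) := by
  apply Subtype.ext
  ext i
  fin_cases i
  · simp [rotate, stereo, rot]; ring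
  · simp [rotate, stereo, rot]; ring
  · simp [rotate, stereo]

theorem stereo_neg_exp (ε : ℤˣ) (t : ℝ) :
    stereo (-ε) (Real.exp t) = stereo ε (Real.exp (-t)) := by
  apply Subtype.ext
  ext i
  fin_cases i
  · simp [stereo, Real.exp_neg, -Complex.ofReal_exp]; field_simp; ring
  · simp [stereo, -Complex.ofReal_exp]
  · simp [stereo, sgn_neg, Real.exp_neg, -Complex.ofReal_exp]; field_simp; ring

theorem stereo_neg_mul_exp (ε : ℤˣ) (z : Circle) (t : ℝ) :
    stereo (-ε) (z * Real.exp t) = stereo ε (z * Real.exp (-t)) := by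
  rw [← rotate_stereo, ← rotate_stereo, stereo_neg_exp]

/-- The angle `x / |x|` of a complex number, with the junk value `1` at `0`. -/
def ang (x : ℂ) : Circle :=
  if h : x = 0 then 1 else ⟨x / ‖x‖, by
    rw [Submonoid.unitSphere, ← SetLike.mem_coe]
    simp [h]⟩

theorem ang_coe {x : ℂ} (h : x ≠ 0) : (ang x : ℂ) = x / ‖x‖ := by simp [ang, h]

theorem ang_mul_norm {x : ℂ} (h : x ≠ 0) : (ang x : ℂ) * ‖x‖ = x := by
  rw [ang_coe h, div_mul_cancel₀]
  simpa using h

theorem ang_circle_mul (z : Circle) {x : ℂ} (h : x ≠ 0) : ang (z * x) = z * ang x := by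
  ext
  rw [Circle.coe_mul, ang_coe h, ang_coe (by simp [h])]
  rw [norm_mul, Circle.norm_coe, one_mul, mul_div_assoc]

theorem ang_ofReal {r : ℝ} (h : 0 < r) : ang r = 1 := by
  ext
  rw [ang_coe (by simpa using h.ne')]
  simp [abs_of_pos h, h.ne']

theorem contMDiffOn_ang : ContMDiffOn 𝓘(ℝ, ℂ) (𝓡 1) ∞ ang {0}ᶜ := by
  apply contMDiffOn_circle_of_coe
  have hnorm : ContDiffOn ℝ ∞ (fun x : ℂ => (‖x‖ : ℂ)) {0}ᶜ :=
    Complex.ofRealCLM.contDiff.comp_contDiffOn (contDiffOn_id.norm ℝ fun _ hx => hx)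
  have hdiv : ContDiffOn ℝ ∞ (fun x : ℂ => x / ‖x‖) {0}ᶜ := by
    simp only [div_eq_mul_inv]
    exact contDiffOn_id.mul (hnorm.inv fun x hx => by simpa using hx)
  exact hdiv.contMDiffOn.congr fun x hx => ang_coe hx

/-! ### Parametric integrals and implicit functions -/

section Analysis

open MeasureTheory

theorem hasFDerivAt_intervalIntegral_param {P W : Type*} [NormedAddCommGroup P] [NormedSpace ℝ P]
    [NormedAddCommGroup W] [NormedSpace ℝ W] {s : Set P} (hs : IsOpen s) {F : P → ℝ → W}
    (hF : ContDiffOn ℝ 1 (fun q : P × ℝ => F q.1 q.2) (s ×ˢ univ)) (a b : ℝ) {p₀ : P}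
    (hp₀ : p₀ ∈ s) :
    HasFDerivAt (fun p => ∫ t in a..b, F p t) (∫ t in a..b, fderiv ℝ (F · t) p₀) p₀ := by
  have hopen : IsOpen (s ×ˢ (univ : Set ℝ)) := hs.prod isOpen_univ
  let F' : P × ℝ → P →L[ℝ] W := fun q =>
    (fderiv ℝ (fun q : P × ℝ => F q.1 q.2) q).comp (.inl ℝ P ℝ)
  have hF' : ContinuousOn F' (s ×ˢ univ) :=
    (hF.continuousOn_fderiv_of_isOpen hopen le_rfl).clm_comp continuousOn_const
  have hd : ∀ p ∈ s, ∀ t, HasFDerivAt (F · t) (F' (p, t)) p := fun p hp t =>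
    HasFDerivAt.comp (f := fun p => (p, t)) p
      ((hF.contDiffAt (hopen.mem_nhds (mk_mem_prod hp (mem_univ t)))).differentiableAt
        one_ne_zero).hasFDerivAt (hasFDerivAt_prodMk_left p t)
  have hFt : ∀ p ∈ s, Continuous (F p) := fun p hp =>
    hF.continuousOn.comp_continuous (f := fun t => (p, t)) (by fun_prop) fun t => ⟨hp, mem_univ _⟩
  have hF't : Continuous fun t => F' (p₀, t) :=
    hF'.comp_continuous (f := fun t => (p₀, t)) (by fun_prop) fun t => ⟨hp₀, mem_univ _⟩
  obtain ⟨C, hC⟩ := isCompact_uIcc.exists_bound_of_continuousOn (s := uIcc a b) hF't.continuousOn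
  have hbound : ∀ᶠ p in 𝓝 p₀, ∀ t ∈ uIcc a b, ‖F' (p, t)‖ < C + 1 :=
    isCompact_uIcc.eventually_forall_of_forall_eventually fun t ht =>
      (hF'.continuousAt (hopen.mem_nhds (mk_mem_prod hp₀ (mem_univ t)))).norm.eventually_lt
        continuousAt_const ((hC t ht).trans_lt (lt_add_one C))
  simp only [(hd p₀ hp₀ _).fderiv]
  exact intervalIntegral.hasFDerivAt_integral_of_dominated_of_fderiv_le
    (F' := fun p t => F' (p, t)) (bound := fun _ => C + 1) (inter_mem (hs.mem_nhds hp₀) hbound)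
    (mem_of_superset (hs.mem_nhds hp₀) fun p hp => (hFt p hp).aestronglyMeasurable)
    ((hFt p₀ hp₀).intervalIntegrable _ _) hF't.aestronglyMeasurable
    (.of_forall fun t ht p hp => (hp.2 t (uIoc_subset_uIcc ht)).le) intervalIntegrable_const
    (.of_forall fun t _ p hp => hd p hp.1 t)

theorem contDiffOn_intervalIntegral_param {P W : Type v} [NormedAddCommGroup P] [NormedSpace ℝ P]
    [NormedAddCommGroup W] [NormedSpace ℝ W] {s : Set P} (hs : IsOpen s) {F : P → ℝ → W}
    (hF : ContDiffOn ℝ ∞ (fun q : P × ℝ => F q.1 q.2) (s ×ˢ univ)) (a b : ℝ) :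
    ContDiffOn ℝ ∞ (fun p => ∫ t in a..b, F p t) s := by
  rw [contDiffOn_infty]
  intro n
  have hderiv {W : Type v} [NormedAddCommGroup W] [NormedSpace ℝ W] {F : P → ℝ → W}
      (hF : ContDiffOn ℝ ∞ (fun q : P × ℝ => F q.1 q.2) (s ×ˢ univ)) {p : P} (hp : p ∈ s) :=
    hasFDerivAt_intervalIntegral_param hs (hF.of_le (mod_cast le_top)) a b hp
  induction n generalizing W with
  | zero =>
    exact contDiffOn_zero.2 fun p hp => (hderiv hF hp).continuousAt.continuousWithinAt
  | succ n ih =>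
    have hF' : ContDiffOn ℝ ∞ (fun q : P × ℝ => fderiv ℝ (F · q.2) q.1) (s ×ˢ univ) := by
      rintro ⟨p, t⟩ hq
      refine (ContDiffAt.fderiv (f := fun (q : P × ℝ) p => F p q.2) (g := Prod.fst) ?_
        contDiffAt_fst (m := ∞) (n := ∞) (by simp)).contDiffWithinAt
      exact (hF.contDiffAt ((hs.prod isOpen_univ).mem_nhds hq)).comp ((p, t), p)
        (f := fun q : (P × ℝ) × P => (q.2, q.1.2)) (by fun_prop)
    rw [Nat.cast_add, Nat.cast_one, contDiffOn_succ_iff_fderiv_of_isOpen hs]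
    refine ⟨fun p hp => (hderiv hF hp).differentiableAt.differentiableWithinAt, by simp, ?_⟩
    exact (ih hF').congr fun p hp => (hderiv hF hp).fderiv

theorem exists_implicit_contDiffAt {X Y Z : Type*} [NormedAddCommGroup X] [NormedSpace ℝ X]
    [CompleteSpace X] [NormedAddCommGroup Y] [NormedSpace ℝ Y] [CompleteSpace Y]
    [NormedAddCommGroup Z] [NormedSpace ℝ Z] [CompleteSpace Z] {f : X × Y → Z} {u : X × Y}
    (hf : ∀ᶠ q in 𝓝 u, ContDiffAt ℝ ∞ f q) (hf' : (fderiv ℝ f u ∘L .inr ℝ X Y).IsInvertible) :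
    ∃ ψ : X → Y, ψ u.1 = u.2 ∧ (∀ᶠ x in 𝓝 u.1, ContDiffAt ℝ ∞ ψ x) ∧
      ∀ᶠ q in 𝓝 u, f q = f u ↔ ψ q.1 = q.2 := by
  have hfu := hf.self_of_nhds
  have hne : (∞ : WithTop ℕ∞) ≠ 0 := by simp
  let ψ := hfu.implicitFunction hne hf'
  have hψ : ContDiffAt ℝ ∞ ψ u.1 := hfu.contDiffAt_implicitFunction hne hf'
  have hψu : ψ u.1 = u.2 := hfu.implicitFunction_apply_self hne hf'
  have hgraph : Tendsto (fun x => (x, ψ x)) (𝓝 u.1) (𝓝 u) := by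
    have := continuousAt_id.prodMk hψ.continuousAt
    rwa [ContinuousAt, id, hψu] at this
  have hinv : ∀ᶠ q in 𝓝 u, (fderiv ℝ f q ∘L .inr ℝ X Y).IsInvertible :=
    (((hfu.fderiv_right (m := 0) (by simp)).continuousAt.clm_comp
      continuousAt_const).eventually (ContinuousLinearEquiv.isOpen.mem_nhds hf'))
  have hcont : ∀ᶠ x in 𝓝 u.1, ContinuousAt ψ x :=
    ((hψ.of_le (m := 1) (mod_cast le_top)).eventually (by simp)).mono fun _ h => h.continuousAt
  have hsol : ∀ᶠ x in 𝓝 u.1, f (x, ψ x) = f u := hfu.eventually_apply_implicitFunction hne hf'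
  refine ⟨ψ, hψu, ?_, hfu.eventually_apply_eq_iff_implicitFunction hne hf'⟩
  filter_upwards [hgraph.eventually hf, hgraph.eventually hinv, hcont, hsol.eventually_nhds]
    with x hfx hinvx hcontx hsolx
  -- near `x`, local uniqueness identifies `ψ` with the implicit function based at `(x, ψ x)`
  refine (hfx.contDiffAt_implicitFunction hne hinvx).congr_of_eventuallyEq ?_
  filter_upwards [(continuousAt_id.prodMk hcontx).eventually
    (hfx.eventually_apply_eq_iff_implicitFunction hne hinvx), hsolx] with y hy hsoly
  exact (hy.1 (hsoly.trans hsolx.self_of_nhds.symm)).symm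

end Analysis

/-! ### Lifts of meridians to principal bundles -/

section Lifts

variable {V : Type v} [NormedAddCommGroup V] [NormedSpace ℝ V]
  {G : Type u} [Group G] [TopologicalSpace G] [ChartedSpace V G]

theorem eventually_exists_smooth_path [LieGroup 𝓘(ℝ, V) ∞ G] :
    ∀ᶠ g in 𝓝 (1 : G), ∃ c : ℝ → G,
      ContMDiff 𝓘(ℝ, ℝ) 𝓘(ℝ, V) ∞ c ∧ (∀ t ≤ 0, c t = 1) ∧ ∀ t, 1 ≤ t → c t = g := by
  let χ := chartAt V (1 : G)
  have h1 : (1 : G) ∈ χ.source := mem_chart_source V 1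
  obtain ⟨r, hr, hball⟩ := Metric.isOpen_iff.1 χ.open_target (χ 1) (χ.map_source h1)
  filter_upwards [χ.open_source.mem_nhds h1,
    χ.continuousAt h1 (Metric.ball_mem_nhds _ hr)] with g hg hgr
  have hmem (t : ℝ) : χ 1 + Real.smoothTransition t • (χ g - χ 1) ∈ χ.target :=
    hball <| (convex_ball (χ 1) r).add_smul_sub_mem (Metric.mem_ball_self hr) hgr
      ⟨Real.smoothTransition.nonneg t, Real.smoothTransition.le_one t⟩
  have hsegment : ContDiff ℝ ∞ fun t => χ 1 + Real.smoothTransition t • (χ g - χ 1) :=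
    contDiff_const.add (Real.smoothTransition.contDiff.smul contDiff_const)
  refine ⟨fun t => χ.symm (χ 1 + Real.smoothTransition t • (χ g - χ 1)),
    contMDiffOn_chart_symm.comp_contMDiff hsegment.contMDiff hmem, fun t ht => ?_, fun t ht => ?_⟩
  · simp [Real.smoothTransition.zero_of_nonpos ht, χ.left_inv h1]
  · simp [Real.smoothTransition.one_of_one_le ht, χ.left_inv hg]

theorem exists_smooth_path [LieGroup 𝓘(ℝ, V) ∞ G] [ConnectedSpace G] (g : G) :
    ∃ c : ℝ → G, ContMDiff 𝓘(ℝ, ℝ) 𝓘(ℝ, V) ∞ c ∧ (∀ t ≤ 0, c t = 1) ∧ ∀ t, 1 ≤ t → c t = g := by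
  have := topologicalGroup_of_lieGroup 𝓘(ℝ, V) ∞ (G := G)
  let S : Subgroup G :=
    { carrier := {g | ∃ c : ℝ → G, ContMDiff 𝓘(ℝ, ℝ) 𝓘(ℝ, V) ∞ c ∧ (∀ t ≤ 0, c t = 1) ∧
        ∀ t, 1 ≤ t → c t = g}
      one_mem' := ⟨fun _ => 1, contMDiff_const, fun _ _ => rfl, fun _ _ => rfl⟩
      mul_mem' := by
        rintro g h ⟨c, hc, hc0, hc1⟩ ⟨d, hd, hd0, hd1⟩
        exact ⟨fun t => c t * d t, hc.mul hd, fun t ht => by simp [hc0 t ht, hd0 t ht],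
          fun t ht => by simp [hc1 t ht, hd1 t ht]⟩
      inv_mem' := by
        rintro g ⟨c, hc, hc0, hc1⟩
        exact ⟨fun t => (c t)⁻¹, hc.inv, fun t ht => by simp [hc0 t ht],
          fun t ht => by simp [hc1 t ht]⟩ }
  have hopen : IsOpen (S : Set G) := S.isOpen_of_mem_nhds eventually_exists_smooth_path
  have huniv : (S : Set G) = univ :=
    IsClopen.eq_univ ⟨S.isClosed_of_isOpen hopen, hopen⟩ ⟨1, S.one_mem⟩
  exact huniv.ge (mem_univ g)

theorem exists_contDiff_eq_const_eq_id {a b : ℝ} (hab : a < b) :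
    ∃ φ : ℝ → ℝ, ContDiff ℝ ∞ φ ∧ (∀ t ≤ a, φ t = a) ∧ (∀ t, b ≤ t → φ t = t) ∧
      ∀ t, a ≤ t → φ t ∈ Icc a t := by
  refine ⟨fun t => a + Real.smoothTransition ((t - a) / (b - a)) * (t - a), ?_, fun t ht => ?_,
    fun t ht => ?_, fun t ht => ?_⟩
  · exact contDiff_const.add ((Real.smoothTransition.contDiff.comp
      ((contDiff_id.sub contDiff_const).div_const _)).mul (contDiff_id.sub contDiff_const))
  · have h := Real.smoothTransition.zero_of_nonpos
      (div_nonpos_of_nonpos_of_nonneg (sub_nonpos.2 ht) (sub_pos.2 hab).le)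
    simp [h]
  · have h := Real.smoothTransition.one_of_one_le
      ((one_le_div (sub_pos.2 hab)).2 (sub_le_sub_right ht a))
    simp [h]
  · have h0 := Real.smoothTransition.nonneg ((t - a) / (b - a))
    have h1 := Real.smoothTransition.le_one ((t - a) / (b - a))
    constructor <;> nlinarith

theorem exists_contMDiffOn_eq_one_eq [LieGroup 𝓘(ℝ, V) ∞ G] [ConnectedSpace G] {t₀ t₁ : ℝ}
    (h01 : t₀ < t₁) {k : ℝ → G} (hk : ContMDiffOn 𝓘(ℝ, ℝ) 𝓘(ℝ, V) ∞ k (Ioo t₀ t₁)) :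
    ∃ K : ℝ → G, ∃ b ∈ Ioo t₀ t₁, ContMDiffOn 𝓘(ℝ, ℝ) 𝓘(ℝ, V) ∞ K (Iio t₁) ∧
      (∀ t ≤ t₀, K t = 1) ∧ ∀ t, b ≤ t → K t = k t := by
  obtain ⟨a, ha0, ha1⟩ := exists_between h01
  obtain ⟨b, hab, hb1⟩ := exists_between ha1
  obtain ⟨c, hc, hc0, hc1⟩ := exists_smooth_path (V := V) (k a)
  obtain ⟨φ, hφ, hφa, hφb, hφ_mem⟩ := exists_contDiff_eq_const_eq_id hab
  have hφ_maps : ∀ t < t₁, φ t ∈ Ioo t₀ t₁ := fun t ht => by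
    rcases le_total t a with h | h
    · rw [hφa t h]; exact ⟨ha0, ha1⟩
    · exact ⟨ha0.trans_le (hφ_mem t h).1, (hφ_mem t h).2.trans_lt ht⟩
  refine ⟨fun t => c ((t - t₀) / (a - t₀)) * (k a)⁻¹ * k (φ t), b, ⟨ha0.trans hab, hb1⟩, ?_,
    fun t ht => ?_, fun t ht => ?_⟩
  · have h_speed : ContDiff ℝ ∞ fun t => (t - t₀) / (a - t₀) :=
      (contDiff_id.sub contDiff_const).div_const _
    exact ((hc.comp h_speed.contMDiff).mul contMDiff_const).contMDiffOn.mul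
      (hk.comp hφ.contMDiff.contMDiffOn hφ_maps)
  · have h := hc0 _ (div_nonpos_of_nonpos_of_nonneg (sub_nonpos.2 ht) (sub_pos.2 ha0).le)
    simp [h, hφa t (ht.trans ha0.le)]
  · have h := hc1 _ ((one_le_div (sub_pos.2 ha0)).2 (sub_le_sub_right (hab.le.trans ht) t₀))
    simp [h, hφb t ht]

namespace PrincipalBundle

variable (η : PrincipalBundle V G)

theorem continuous_proj : Continuous η.proj := η.proj_smooth.continuous

theorem continuous_act : Continuous fun q : η.E × G => η.act q.1 q.2 := η.act_smooth.continuous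

/-- A smooth local section `sec` of a principal bundle, together with the fibre coordinate of the
local trivialization that it induces. -/
structure LocalSection where
  /-- The open set over which the section is defined. -/
  base : Set S2
  /-- The section; only its values on `base` matter. -/
  sec : S2 → η.E
  /-- The fibre coordinate; only its values over `base` matter. -/
  fib : η.E → G
  isOpen_base : IsOpen base
  contMDiffOn_sec : ContMDiffOn (𝓡 2) (totalModel V) ∞ sec base
  contMDiffOn_fib : ContMDiffOn (totalModel V) 𝓘(ℝ, V) ∞ fib (η.proj ⁻¹' base)
  proj_sec : ∀ x ∈ base, η.proj (sec x) = x
  act_sec_fib : ∀ p, η.proj p ∈ base → η.act (sec (η.proj p)) (fib p) = p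

variable {η} in
theorem LocalSection.fib_act (T : η.LocalSection) {p : η.E} (hp : η.proj p ∈ T.base) (g : G) :
    T.fib (η.act p g) = T.fib p * g := by
  have h := T.act_sec_fib (η.act p g) (by rwa [η.proj_act])
  rw [η.proj_act] at h
  apply η.act_left_cancel (z := T.sec (η.proj p))
  rw [h, η.act_mul, T.act_sec_fib p hp]

variable {η} in
theorem LocalSection.fib_sec (T : η.LocalSection) {x : S2} (hx : x ∈ T.base) :
    T.fib (T.sec x) = 1 := by
  have h := T.act_sec_fib (T.sec x) (by rwa [T.proj_sec x hx])
  rw [T.proj_sec x hx] at h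
  exact η.act_free _ _ h

variable {η} in
theorem LocalSection.contMDiffAt_fib (T : η.LocalSection) {p : η.E} (hp : η.proj p ∈ T.base) :
    ContMDiffAt (totalModel V) 𝓘(ℝ, V) ∞ T.fib p :=
  T.contMDiffOn_fib.contMDiffAt ((T.isOpen_base.preimage η.continuous_proj).mem_nhds hp)

variable {η} in
theorem LocalSection.contMDiffAt_sec (T : η.LocalSection) {x : S2} (hx : x ∈ T.base) :
    ContMDiffAt (𝓡 2) (totalModel V) ∞ T.sec x :=
  T.contMDiffOn_sec.contMDiffAt (T.isOpen_base.mem_nhds hx)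

theorem exists_localSection [LieGroup 𝓘(ℝ, V) ∞ G] (a : η.E) :
    ∃ T : η.LocalSection, η.proj a ∈ T.base ∧ T.sec (η.proj a) = a := by
  obtain ⟨e, hxe, he, he_symm, he_act⟩ := η.locally_trivial (η.proj a)
  have hae : a ∈ e.source := e.mem_source.2 hxe
  have htarget : ∀ x ∈ e.baseSet, (x, (e a).2) ∈ e.target := fun x hx => by
    simpa [e.target_eq] using hx
  refine ⟨{ base := e.baseSet
            sec := fun x => e.toOpenPartialHomeomorph.symm (x, (e a).2)
            fib := fun p => (e a).2⁻¹ * (e p).2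
            isOpen_base := e.open_baseSet
            contMDiffOn_sec :=
              he_symm.comp (contMDiff_id.prodMk contMDiff_const).contMDiffOn htarget
            contMDiffOn_fib := ?_
            proj_sec := fun x hx => e.proj_symm_apply' hx
            act_sec_fib := fun p hp => ?_ }, hxe, ?_⟩
  · rw [← e.source_eq]
    exact contMDiffOn_const.mul (contMDiff_snd.comp_contMDiffOn he)
  · have hsec : e.toOpenPartialHomeomorph.symm (η.proj p, (e a).2) ∈ e.source :=
      e.map_target (htarget _ hp)
    have hpe : p ∈ e.source := e.mem_source.2 hp
    refine e.injOn ?_ hpe (?_ : e _ = e _)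
    · rwa [e.mem_source, η.proj_act, e.proj_symm_apply' hp]
    · rw [he_act _ hsec, e.apply_symm_apply' hp, mul_inv_cancel_left, ← e.coe_fst hpe]
  · have h : (η.proj a, (e a).2) = e a := by rw [← e.coe_fst hae]
    simp only [h]
    exact e.left_inv hae

variable {η} in
theorem LocalSection.eq_inv_fib_mul_fib (T : η.LocalSection) {p q : η.E} {g : G}
    (hp : η.proj p ∈ T.base) (h : q = η.act p g) : g = (T.fib p)⁻¹ * T.fib q := by
  rw [h, T.fib_act hp, inv_mul_cancel_left]

section Smooth

variable {F : Type*} [NormedAddCommGroup F] [NormedSpace ℝ F] {H : Type*} [TopologicalSpace H]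
  {I : ModelWithCorners ℝ F H} {M : Type*} [TopologicalSpace M] [ChartedSpace H M]

theorem contMDiffOn_act {s : Set M} {f : M → η.E} {k : M → G}
    (hf : ContMDiffOn I (totalModel V) ∞ f s) (hk : ContMDiffOn I 𝓘(ℝ, V) ∞ k s) :
    ContMDiffOn I (totalModel V) ∞ (fun x => η.act (f x) (k x)) s :=
  η.act_smooth.comp_contMDiffOn (hf.prodMk hk)

theorem contMDiffOn_of_act_eq [LieGroup 𝓘(ℝ, V) ∞ G] {s : Set M} {f g : M → η.E} {k : M → G}
    (hf : ContMDiffOn I (totalModel V) ∞ f s) (hg : ContMDiffOn I (totalModel V) ∞ g s)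
    (h : ∀ x ∈ s, g x = η.act (f x) (k x)) : ContMDiffOn I 𝓘(ℝ, V) ∞ k s := by
  intro x hx
  obtain ⟨T, hT, -⟩ := η.exists_localSection (f x)
  have hT' : η.proj (g x) ∈ T.base := by rwa [h x hx, η.proj_act]
  refine (((T.contMDiffAt_fib hT).comp_contMDiffWithinAt x (hf x hx)).inv.mul
    ((T.contMDiffAt_fib hT').comp_contMDiffWithinAt x (hg x hx))).congr_of_eventuallyEq ?_
    (T.eq_inv_fib_mul_fib hT (h x hx))
  filter_upwards [(hf x hx).continuousWithinAt.eventually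
    ((T.isOpen_base.preimage η.continuous_proj).mem_nhds hT), self_mem_nhdsWithin] with y hy hys
    using T.eq_inv_fib_mul_fib hy (h y hys)

end Smooth

theorem continuous_of_act_eq [LieGroup 𝓘(ℝ, V) ∞ G] {M : Type*} [TopologicalSpace M]
    {f g : M → η.E} {k : M → G} (hf : Continuous f) (hg : Continuous g)
    (h : ∀ x, g x = η.act (f x) (k x)) : Continuous k := by
  have := topologicalGroup_of_lieGroup 𝓘(ℝ, V) ∞ (G := G)
  rw [continuous_iff_continuousAt]
  intro x
  obtain ⟨T, hT, -⟩ := η.exists_localSection (f x)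
  have hT' : η.proj (g x) ∈ T.base := by rwa [h x, η.proj_act]
  refine (((T.contMDiffAt_fib hT).continuousAt.comp hf.continuousAt).inv.mul
    ((T.contMDiffAt_fib hT').continuousAt.comp hg.continuousAt)).congr ?_
  filter_upwards [hf.continuousAt.eventually
    ((T.isOpen_base.preimage η.continuous_proj).mem_nhds hT)] with y hy
    using (T.eq_inv_fib_mul_fib hy (h y)).symm

/-- `σ` is a smooth lift of the curve `m` over the parameter set `s`. -/
def IsLiftOn (m : ℝ → S2) (σ : ℝ → η.E) (s : Set ℝ) : Prop :=
  ContMDiffOn 𝓘(ℝ, ℝ) (totalModel V) ∞ σ s ∧ ∀ t ∈ s, η.proj (σ t) = m t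

variable {η} {m : ℝ → S2} {σ₁ σ₂ : ℝ → η.E}

theorem IsLiftOn.mono {s t : Set ℝ} (h : η.IsLiftOn m σ₁ t) (hst : s ⊆ t) : η.IsLiftOn m σ₁ s :=
  ⟨h.1.mono hst, fun x hx => h.2 x (hst hx)⟩

theorem IsLiftOn.exists_act_eq [LieGroup 𝓘(ℝ, V) ∞ G] {s : Set ℝ} (h₁ : η.IsLiftOn m σ₁ s)
    (h₂ : η.IsLiftOn m σ₂ s) :
    ∃ k : ℝ → G, ContMDiffOn 𝓘(ℝ, ℝ) 𝓘(ℝ, V) ∞ k s ∧ ∀ t ∈ s, σ₂ t = η.act (σ₁ t) (k t) := by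
  have hex (t : ℝ) : ∃ k, t ∈ s → σ₂ t = η.act (σ₁ t) k := by
    by_cases ht : t ∈ s
    · obtain ⟨k, hk⟩ := η.exists_act_eq ((h₂.2 t ht).trans (h₁.2 t ht).symm)
      exact ⟨k, fun _ => hk⟩
    · exact ⟨1, fun h => absurd h ht⟩
  choose k hk using hex
  exact ⟨k, η.contMDiffOn_of_act_eq h₁.1 h₂.1 hk, hk⟩

theorem IsLiftOn.exists_join [LieGroup 𝓘(ℝ, V) ∞ G] [ConnectedSpace G] {J : Set ℝ}
    (hJ : IsOpen J) {t₀ t₁ : ℝ} (h01 : t₀ < t₁) (htJ : Iio t₁ ⊆ J)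
    (h₁ : η.IsLiftOn m σ₁ (Iio t₁)) (h₂ : η.IsLiftOn m σ₂ (Ioi t₀ ∩ J)) :
    ∃ σ : ℝ → η.E, η.IsLiftOn m σ J ∧ EqOn σ σ₁ (Iic t₀) ∧ EqOn σ σ₂ (Ici t₁) := by
  obtain ⟨k, hk, hk_act⟩ := (h₁.mono fun t (ht : t ∈ Ioo t₀ t₁) => ht.2).exists_act_eq
    (h₂.mono fun t ht => ⟨ht.1, htJ ht.2⟩)
  obtain ⟨K, b, ⟨hb0, hb1⟩, hK, hK_one, hK_eq⟩ := exists_contMDiffOn_eq_one_eq h01 hk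
  let σ : ℝ → η.E := fun t => if t < t₁ then η.act (σ₁ t) (K t) else σ₂ t
  have hσ_lt : ∀ t < t₁, σ t = η.act (σ₁ t) (K t) := fun t ht => if_pos ht
  have hσ_gt : ∀ t, b < t → σ t = σ₂ t := fun t ht => by
    by_cases h : t < t₁
    · rw [hσ_lt t h, hK_eq t ht.le, hk_act t ⟨hb0.trans ht, h⟩]
    · exact if_neg h
  refine ⟨σ, ⟨fun t ht => ContMDiffAt.contMDiffWithinAt ?_, fun t ht => ?_⟩, fun t ht => ?_,
    fun t ht => hσ_gt t (hb1.trans_le ht)⟩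
  · rcases lt_or_ge t t₁ with h | h
    · refine ((η.contMDiffOn_act h₁.1 hK).contMDiffAt (Iio_mem_nhds h)).congr_of_eventuallyEq ?_
      filter_upwards [Iio_mem_nhds h] with s hs using hσ_lt s hs
    · have hmem : Ioi t₀ ∩ J ∈ 𝓝 t := inter_mem (Ioi_mem_nhds (h01.trans_le h)) (hJ.mem_nhds ht)
      refine (h₂.1.contMDiffAt hmem).congr_of_eventuallyEq ?_
      filter_upwards [Ioi_mem_nhds (hb1.trans_le h)] with s hs using hσ_gt s hs
  · rcases lt_or_ge t t₁ with h | h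
    · rw [hσ_lt t h, η.proj_act, h₁.2 t h]
    · rw [hσ_gt t (hb1.trans_le h), h₂.2 t ⟨h01.trans_le h, ht⟩]
  · rw [hσ_lt t (lt_of_le_of_lt ht h01), hK_one t ht, η.act_one]

variable (η) in
theorem exists_isLiftOn_Ioo [LieGroup 𝓘(ℝ, V) ∞ G] (hm : ContMDiff 𝓘(ℝ, ℝ) (𝓡 2) ∞ m) (t : ℝ) :
    ∃ δ > 0, ∃ σ, η.IsLiftOn m σ (Ioo (t - δ) (t + δ)) := by
  obtain ⟨a, ha⟩ := η.exists_point (m t)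
  obtain ⟨T, haT, -⟩ := η.exists_localSection a
  rw [ha] at haT
  obtain ⟨δ, hδ, hball⟩ := Metric.isOpen_iff.1 (T.isOpen_base.preimage hm.continuous) t haT
  rw [Real.ball_eq_Ioo] at hball
  exact ⟨δ, hδ, fun s => T.sec (m s), T.contMDiffOn_sec.comp hm.contMDiffOn hball,
    fun s hs => T.proj_sec _ (hball hs)⟩

theorem IsLiftOn.exists_extend_Iio [LieGroup 𝓘(ℝ, V) ∞ G] [ConnectedSpace G]
    (hm : ContMDiff 𝓘(ℝ, ℝ) (𝓡 2) ∞ m) {t₀ t₁ : ℝ} (h01 : t₀ < t₁)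
    (h₁ : η.IsLiftOn m σ₁ (Iio t₁)) (T : ℝ) :
    ∃ σ, η.IsLiftOn m σ (Iio T) ∧ EqOn σ σ₁ (Iic t₀) := by
  let S : Set ℝ := {t | ∃ σ, η.IsLiftOn m σ (Iio t) ∧ EqOn σ σ₁ (Iic t₀)}
  have ht₁ : t₁ ∈ S := ⟨σ₁, h₁, fun _ _ => rfl⟩
  have hstep : ∀ t, t₁ ≤ t → ∃ δ > 0, ∀ r ∈ S, t - δ < r → r < t + δ → t + δ ∈ S := by
    intro t ht
    obtain ⟨δ, hδ, τ, hτ⟩ := η.exists_isLiftOn_Ioo hm t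
    have hle := min_le_left δ (t₁ - t₀)
    have hle' := min_le_right δ (t₁ - t₀)
    refine ⟨min δ (t₁ - t₀), lt_min hδ (sub_pos.2 h01), ?_⟩
    rintro r ⟨σ, hσ, hσ_eq⟩ hr hr'
    obtain ⟨σ', hσ', hσ'_eq, -⟩ := hσ.exists_join isOpen_Iio hr (Iio_subset_Iio hr'.le)
      (hτ.mono fun s hs => ⟨by linarith [mem_Ioi.1 hs.1], by linarith [mem_Iio.1 hs.2]⟩)
    exact ⟨σ', hσ', fun s hs =>
      (hσ'_eq (mem_Iic.2 (by linarith [mem_Iic.1 hs]))).trans (hσ_eq hs)⟩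
  have hunbounded : ¬ BddAbove S := fun hS => by
    obtain ⟨δ, hδ, h⟩ := hstep (sSup S) (le_csSup hS ht₁)
    obtain ⟨r, hrS, hr⟩ := exists_lt_of_lt_csSup ⟨t₁, ht₁⟩ (sub_lt_self (sSup S) hδ)
    have := le_csSup hS (h r hrS hr (by linarith [le_csSup hS hrS]))
    linarith
  obtain ⟨r, ⟨σ, hσ, hσ_eq⟩, hr⟩ := not_bddAbove_iff.1 hunbounded T
  exact ⟨σ, hσ.mono (Iio_subset_Iio hr.le), hσ_eq⟩

theorem exists_isLiftOn_univ [LieGroup 𝓘(ℝ, V) ∞ G] [ConnectedSpace G]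
    (hm : ContMDiff 𝓘(ℝ, ℝ) (𝓡 2) ∞ m) {t₀ t₁ : ℝ} (h₁ : η.IsLiftOn m σ₁ (Iio t₁))
    (h₂ : η.IsLiftOn m σ₂ (Ioi t₀)) :
    ∃ σ, η.IsLiftOn m σ univ ∧ σ =ᶠ[atBot] σ₁ ∧ σ =ᶠ[atTop] σ₂ := by
  obtain ⟨σ, hσ, hσ_eq⟩ := h₁.exists_extend_Iio hm (sub_one_lt t₁) (max t₀ t₁ + 1)
  obtain ⟨τ, hτ, hτ_bot, hτ_top⟩ := hσ.exists_join isOpen_univ (lt_add_one (max t₀ t₁))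
    (subset_univ _) (h₂.mono fun t ht => (le_max_left t₀ t₁).trans_lt ht.1)
  refine ⟨τ, hτ, ?_, ?_⟩
  · filter_upwards [eventually_le_atBot (t₁ - 1)] with t ht
    have ht' : t ≤ max t₀ t₁ := by linarith [le_max_right t₀ t₁]
    exact (hτ_bot ht').trans (hσ_eq ht)
  · filter_upwards [eventually_ge_atTop (max t₀ t₁ + 1)] with t ht using hτ_top ht

end PrincipalBundle

end Lifts

/-! ### Equivariant sections near a pole, by averaging -/

section Adjoint

variable {V : Type v} [NormedAddCommGroup V] [NormedSpace ℝ V]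
  {G : Type u} [Group G] [TopologicalSpace G] [ChartedSpace V G]

variable (V G) in
/-- The preferred chart of the Lie group at its identity. -/
abbrev oneChart : OpenPartialHomeomorph G V := chartAt V 1

/-- The adjoint representation, that is the differential at `1` of the conjugation by `g`, read in
the chart `oneChart V G`. -/
def adjoint (V : Type v) [NormedAddCommGroup V] [NormedSpace ℝ V] [ChartedSpace V G] (g : G) :
    V →L[ℝ] V :=
  fderiv ℝ (fun v => oneChart V G (g * (oneChart V G).symm v * g⁻¹)) (oneChart V G 1)

variable [LieGroup 𝓘(ℝ, V) ∞ G]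

theorem contDiffAt_conj_oneChart {P : Type*} [NormedAddCommGroup P] [NormedSpace ℝ P] {c : P → G}
    (hc : ContMDiff 𝓘(ℝ, P) 𝓘(ℝ, V) ∞ c) (p : P) :
    ContDiffAt ℝ ∞ (fun q : P × V => oneChart V G (c q.1 * (oneChart V G).symm q.2 * (c q.1)⁻¹))
      (p, oneChart V G 1) := by
  have h_one : c p * (oneChart V G).symm (oneChart V G 1) * (c p)⁻¹ = 1 := by simp
  have hc' : ContMDiffAt 𝓘(ℝ, P × V) 𝓘(ℝ, V) ∞ (fun q : P × V => c q.1)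
      (p, oneChart V G 1) :=
    (hc.comp contDiff_fst.contMDiff).contMDiffAt
  have h_symm : ContMDiffAt 𝓘(ℝ, P × V) 𝓘(ℝ, V) ∞
      (fun q : P × V => (oneChart V G).symm q.2) (p, oneChart V G 1) :=
    (contMDiffOn_chart_symm.contMDiffAt ((oneChart V G).open_target.mem_nhds
      (mem_chart_target V 1))).comp (p, oneChart V G 1) contDiff_snd.contMDiff.contMDiffAt
  refine ContMDiffAt.contDiffAt (ContMDiffAt.comp _ ?_ ((hc'.mul h_symm).mul hc'.inv))
  exact contMDiffOn_chart.contMDiffAt ((oneChart V G).open_source.mem_nhds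
    (by rw [h_one]; exact mem_chart_source V 1))

theorem hasFDerivAt_adjoint (g : G) :
    HasFDerivAt (fun v => oneChart V G (g * (oneChart V G).symm v * g⁻¹)) (adjoint V g)
      (oneChart V G 1) :=
  (((contDiffAt_conj_oneChart (contMDiff_const (c := g)) (0 : V)).comp (oneChart V G 1)
    (contDiffAt_const.prodMk contDiffAt_id)).differentiableAt (by simp)).hasFDerivAt

theorem adjoint_one : adjoint V (1 : G) = .id ℝ V := by
  refine (hasFDerivAt_adjoint 1).unique ((hasFDerivAt_id _).congr_of_eventuallyEq ?_)
  filter_upwards [(oneChart V G).open_target.mem_nhds (mem_chart_target V 1)] with v hv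
  simp [(oneChart V G).right_inv hv]

theorem adjoint_mul (g h : G) : adjoint V (g * h) = adjoint V g ∘L adjoint V h := by
  have h_one : h * (oneChart V G).symm (oneChart V G 1) * h⁻¹ = 1 := by simp
  have hg : HasFDerivAt (fun v => oneChart V G (g * (oneChart V G).symm v * g⁻¹)) (adjoint V g)
      (oneChart V G (h * (oneChart V G).symm (oneChart V G 1) * h⁻¹)) := by
    rw [h_one]
    exact hasFDerivAt_adjoint g
  refine (hasFDerivAt_adjoint (g * h)).unique
    ((HasFDerivAt.comp (oneChart V G 1) hg (hasFDerivAt_adjoint h)).congr_of_eventuallyEq ?_)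
  have := topologicalGroup_of_lieGroup 𝓘(ℝ, V) ∞ (G := G)
  have h_cont : ContinuousAt (fun v => h * (oneChart V G).symm v * h⁻¹) (oneChart V G 1) :=
    (continuousAt_const.mul
      ((oneChart V G).continuousAt_symm (mem_chart_target V 1))).mul continuousAt_const
  have h_mem := (oneChart V G).open_source.mem_nhds (mem_chart_source V (1 : G))
  rw [← h_one] at h_mem
  filter_upwards [h_cont.eventually h_mem] with v hv
  rw [Function.comp_apply, (oneChart V G).left_inv hv]
  group

theorem contDiff_adjoint {P : Type*} [NormedAddCommGroup P] [NormedSpace ℝ P] {c : P → G}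
    (hc : ContMDiff 𝓘(ℝ, P) 𝓘(ℝ, V) ∞ c) : ContDiff ℝ ∞ fun p => adjoint V (c p) :=
  contDiff_iff_contDiffAt.2 fun p =>
    (contDiffAt_conj_oneChart hc p).fderiv contDiffAt_const (by simp)

/-- The adjoint representation through linear automorphisms. -/
def adjointEquiv (V : Type v) [NormedAddCommGroup V] [NormedSpace ℝ V] [ChartedSpace V G]
    [LieGroup 𝓘(ℝ, V) ∞ G] (g : G) : V ≃L[ℝ] V :=
  .equivOfInverse (adjoint V g) (adjoint V g⁻¹)
    (fun v => by
      rw [← ContinuousLinearMap.comp_apply, ← adjoint_mul, inv_mul_cancel, adjoint_one]; rfl)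
    (fun v => by
      rw [← ContinuousLinearMap.comp_apply, ← adjoint_mul, mul_inv_cancel, adjoint_one]; rfl)

end Adjoint

section Slice

variable {V : Type v} [NormedAddCommGroup V] [NormedSpace ℝ V]
  {G : Type u} [Group G] [TopologicalSpace G] [ChartedSpace V G]

namespace EquivariantPrincipalBundle

section Twist

variable (ξ : EquivariantPrincipalBundle V G)

theorem contMDiffOn_rotAct {F : Type*} [NormedAddCommGroup F] [NormedSpace ℝ F] {H : Type*}
    [TopologicalSpace H] {I : ModelWithCorners ℝ F H} {M : Type*} [TopologicalSpace M]
    [ChartedSpace H M] {s : Set M} {f : M → ξ.E} {A : M → SO2}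
    (hA : ContMDiffOn I (𝓡 1) ∞ A s) (hf : ContMDiffOn I (totalModel V) ∞ f s) :
    ContMDiffOn I (totalModel V) ∞ (fun x => ξ.rotAct (A x) (f x)) s :=
  ξ.rotAct_smooth.comp_contMDiffOn (hA.prodMk hf)

/-- The action of the circle on the total space by `p ↦ z · p · γ(z)⁻¹`, for which the points with
isotropy representation `γ` are fixed. -/
def twist (γ : SmoothHom V G) (z : Circle) (p : ξ.E) : ξ.E :=
  ξ.act (ξ.rotAct (rot z) p) (γ (rot z))⁻¹

variable {ξ} {γ : SmoothHom V G}

theorem twist_mul (z w : Circle) (p : ξ.E) : ξ.twist γ (z * w) p = ξ.twist γ z (ξ.twist γ w p) := by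
  simp only [twist, rot_mul, map_mul, mul_inv_rev, ξ.rotAct_mul, ξ.rotAct_act, ξ.act_mul]

theorem twist_one (p : ξ.E) : ξ.twist γ 1 p = p := by
  simp only [twist, rot_one, map_one, inv_one, ξ.rotAct_one, ξ.act_one]

theorem proj_twist (z : Circle) (p : ξ.E) :
    ξ.proj (ξ.twist γ z p) = rotate (rot z) (ξ.proj p) := by
  rw [twist, ξ.proj_act, ξ.proj_rotAct]

theorem rotAct_eq_act_twist (z : Circle) (p : ξ.E) :
    ξ.rotAct (rot z) p = ξ.act (ξ.twist γ z p) (γ (rot z)) := by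
  rw [twist, ← ξ.act_mul, inv_mul_cancel, ξ.act_one]

theorem twist_act_of_rotAct_eq {a : ξ.E} (hγ : ∀ A, ξ.rotAct A a = ξ.act a (γ A)) (z : Circle)
    (g : G) : ξ.twist γ z (ξ.act a g) = ξ.act a (γ (rot z) * g * (γ (rot z))⁻¹) := by
  simp only [twist, ξ.rotAct_act, hγ, ξ.act_mul]

theorem twist_eq_self_of_rotAct_eq {a : ξ.E} (hγ : ∀ A, ξ.rotAct A a = ξ.act a (γ A))
    (z : Circle) : ξ.twist γ z a = a := by
  rw [twist, hγ, ← ξ.act_mul, mul_inv_cancel, ξ.act_one]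

theorem contMDiffOn_twist [LieGroup 𝓘(ℝ, V) ∞ G] {F : Type*} [NormedAddCommGroup F]
    [NormedSpace ℝ F] {H : Type*} [TopologicalSpace H] {I : ModelWithCorners ℝ F H} {M : Type*}
    [TopologicalSpace M] [ChartedSpace H M] {s : Set M} {f : M → ξ.E} {z : M → Circle}
    (hz : ContMDiffOn I (𝓡 1) ∞ z s) (hf : ContMDiffOn I (totalModel V) ∞ f s) :
    ContMDiffOn I (totalModel V) ∞ (fun x => ξ.twist γ (z x) (f x)) s := by
  have hA := contMDiff_rot.comp_contMDiffOn hz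
  exact ξ.contMDiffOn_act (ξ.contMDiffOn_rotAct hA hf) (γ.contMDiff_toFun.comp_contMDiffOn hA).inv

theorem continuous_twist [LieGroup 𝓘(ℝ, V) ∞ G] :
    Continuous fun q : Circle × ξ.E => ξ.twist γ q.1 q.2 := by
  refine (contMDiffOn_univ.1 (contMDiffOn_twist (I := (𝓡 1).prod (totalModel V))
    contMDiff_fst.contMDiffOn contMDiff_snd.contMDiffOn)).continuous

theorem eventually_forall_twist_mem [LieGroup 𝓘(ℝ, V) ∞ G] {a : ξ.E}
    (hγ : ∀ A, ξ.rotAct A a = ξ.act a (γ A)) {W : Set ξ.E} (hW : W ∈ 𝓝 a) :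
    ∀ᶠ p in 𝓝 a, ∀ z, ξ.twist γ z p ∈ W := by
  have h := isCompact_univ.eventually_forall_of_forall_eventually
    (x₀ := a) (K := (univ : Set Circle)) (P := fun p z => ξ.twist γ z p ∈ W) fun z _ =>
      (continuous_twist.comp continuous_swap).continuousAt.eventually (by
        rwa [Function.comp_apply, Prod.swap_prod_mk, twist_eq_self_of_rotAct_eq hγ z])
  simpa using h

end Twist

section Average

variable {ξ : EquivariantPrincipalBundle V G} (T : ξ.LocalSection) (γ : SmoothHom V G)

/-- The fibre coordinate of the point `p` moved by the twist with `exp (it)`, read in the chart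
`oneChart V G` centred at `1`, and moved back by the adjoint representation. -/
def twistedFib (p : ξ.E) (t : ℝ) : V :=
  adjoint V (γ (rot (Circle.exp (-t))))
    (oneChart V G (T.fib (ξ.twist γ (Circle.exp t) p)) - oneChart V G 1)

/-- The average of the twisted fibre coordinates over the circle. Its zero set is invariant under
the twist, and it is a smooth section near a fixed point of the twist. -/
def averagedFib (p : ξ.E) : V :=
  ∫ t in (0 : ℝ)..2 * Real.pi, twistedFib T γ p t

variable {T γ}

theorem periodic_twistedFib (p : ξ.E) : (twistedFib T γ p).Periodic (2 * Real.pi) := fun t => by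
  simp only [twistedFib, neg_add, Circle.exp_add, Circle.exp_neg, Circle.exp_two_pi, inv_one,
    mul_one]

theorem averagedFib_eq_zero {a : ξ.E} (hT : T.fib a = 1)
    (hγ : ∀ A, ξ.rotAct A a = ξ.act a (γ A)) : averagedFib T γ a = 0 := by
  simp only [averagedFib, twistedFib, twist_eq_self_of_rotAct_eq hγ, hT, sub_self, map_zero,
    intervalIntegral.integral_zero]

variable [LieGroup 𝓘(ℝ, V) ∞ G]

theorem twistedFib_twist_exp (s : ℝ) (p : ξ.E) (t : ℝ) :
    twistedFib T γ (ξ.twist γ (Circle.exp s) p) t =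
      adjointEquiv V (γ (rot (Circle.exp s))) (twistedFib T γ p (t + s)) := by
  change _ = adjoint V _ (adjoint V _ _)
  rw [← ContinuousLinearMap.comp_apply, ← adjoint_mul, ← map_mul, ← rot_mul, ← Circle.exp_add,
    twistedFib, ← twist_mul, ← Circle.exp_add, neg_add, add_comm (-t), add_neg_cancel_left]

theorem averagedFib_twist (z : Circle) (p : ξ.E) :
    averagedFib T γ (ξ.twist γ z p) = adjointEquiv V (γ (rot z)) (averagedFib T γ p) := by
  obtain ⟨s, rfl⟩ := Circle.exp_surjective z
  calc averagedFib T γ (ξ.twist γ (Circle.exp s) p)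
    _ = ∫ t in (0 : ℝ)..2 * Real.pi,
          adjointEquiv V (γ (rot (Circle.exp s))) (twistedFib T γ p (t + s)) :=
      intervalIntegral.integral_congr fun t _ => twistedFib_twist_exp s p t
    _ = adjointEquiv V (γ (rot (Circle.exp s)))
          (∫ t in (0 : ℝ)..2 * Real.pi, twistedFib T γ p (t + s)) := by
      simp only [intervalIntegral.integral_of_le Real.two_pi_pos.le]
      exact ContinuousLinearEquiv.integral_comp_comm _ _
    _ = adjointEquiv V (γ (rot (Circle.exp s))) (averagedFib T γ p) := by
      rw [intervalIntegral.integral_comp_add_right, zero_add, add_comm _ s,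
        (periodic_twistedFib p).intervalIntegral_add_eq s 0, zero_add, averagedFib]

theorem exists_contDiffOn_twistedFib {P : Type*} [NormedAddCommGroup P] [NormedSpace ℝ P]
    {σ : P → ξ.E} {u : P} (hσ : ∀ᶠ q in 𝓝 u, ContMDiffAt 𝓘(ℝ, P) (totalModel V) ∞ σ q)
    (hγ : ∀ A, ξ.rotAct A (σ u) = ξ.act (σ u) (γ A)) (hu : ξ.proj (σ u) ∈ T.base)
    (hT : T.fib (σ u) = 1) :
    ∃ O ∈ 𝓝 u, IsOpen O ∧
      ContDiffOn ℝ ∞ (fun q : P × ℝ => twistedFib T γ (σ q.1) q.2) (O ×ˢ univ) := by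
  have h_chart : ∀ᶠ p in 𝓝 (σ u), T.fib p ∈ (oneChart V G).source :=
    (T.contMDiffAt_fib hu).continuousAt.eventually
      ((oneChart V G).open_source.mem_nhds (hT ▸ mem_chart_source V 1))
  have h_base : ∀ᶠ p in 𝓝 (σ u), ξ.proj p ∈ T.base :=
    (T.isOpen_base.preimage ξ.continuous_proj).mem_nhds hu
  have h_near := hσ.self_of_nhds.continuousAt.eventually
    (eventually_forall_twist_mem hγ (h_base.and h_chart))
  obtain ⟨O, hO_sub, hO, huO⟩ := eventually_nhds_iff.1 (h_near.and hσ)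
  have hexp : ContMDiff 𝓘(ℝ, P × ℝ) (𝓡 1) ∞ fun q : P × ℝ => Circle.exp q.2 :=
    contMDiff_circleExp.comp contDiff_snd.contMDiff
  have hexp_neg : ContMDiff 𝓘(ℝ, P × ℝ) (𝓡 1) ∞ fun q : P × ℝ => Circle.exp (-q.2) :=
    contMDiff_circleExp.comp contDiff_snd.neg.contMDiff
  have h_twist : ContMDiffOn 𝓘(ℝ, P × ℝ) (totalModel V) ∞
      (fun q : P × ℝ => ξ.twist γ (Circle.exp q.2) (σ q.1)) (O ×ˢ univ) :=
    contMDiffOn_twist hexp.contMDiffOn fun q hq =>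
      ((hO_sub _ hq.1).2.comp q contDiff_fst.contMDiff.contMDiffAt).contMDiffWithinAt
  have h_coord : ContMDiffOn 𝓘(ℝ, P × ℝ) 𝓘(ℝ, V) ∞
      (fun q : P × ℝ => oneChart V G (T.fib (ξ.twist γ (Circle.exp q.2) (σ q.1)))) (O ×ˢ univ) :=
    contMDiffOn_chart.comp (T.contMDiffOn_fib.comp h_twist fun q hq => ((hO_sub _ hq.1).1 _).1)
      fun q hq => ((hO_sub _ hq.1).1 _).2
  have h_adj := contDiff_adjoint (V := V)
    (γ.contMDiff_toFun.comp (contMDiff_rot.comp hexp_neg))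
  exact ⟨O, hO.mem_nhds huO, hO,
    h_adj.contDiffOn.clm_apply (h_coord.contDiffOn.sub contDiffOn_const)⟩

theorem hasFDerivAt_twistedFib_act {a : ξ.E} (hγ : ∀ A, ξ.rotAct A a = ξ.act a (γ A))
    (ha : ξ.proj a ∈ T.base) (hT : T.fib a = 1) (t : ℝ) :
    HasFDerivAt (fun v => twistedFib T γ (ξ.act a ((oneChart V G).symm v)) t) (.id ℝ V)
      (oneChart V G 1) := by
  have h := (adjoint V (γ (rot (Circle.exp (-t))))).hasFDerivAt.comp (oneChart V G 1)
    ((hasFDerivAt_adjoint (γ (rot (Circle.exp t)))).sub_const (oneChart V G 1))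
  rw [← adjoint_mul, ← map_mul, ← rot_mul, ← Circle.exp_add, neg_add_cancel, Circle.exp_zero,
    rot_one, map_one, adjoint_one] at h
  refine h.congr_of_eventuallyEq (.of_forall fun v => ?_)
  simp only [twistedFib, twist_act_of_rotAct_eq hγ, T.fib_act ha, hT, one_mul, Function.comp_apply]

theorem hasFDerivAt_averagedFib_act [CompleteSpace V] {a : ξ.E}
    (hγ : ∀ A, ξ.rotAct A a = ξ.act a (γ A))
    (ha : ξ.proj a ∈ T.base) (hT : T.fib a = 1) :
    HasFDerivAt (fun v => averagedFib T γ (ξ.act a ((oneChart V G).symm v)))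
      ((2 * Real.pi) • .id ℝ V) (oneChart V G 1) := by
  have ha_eq : ξ.act a ((oneChart V G).symm (oneChart V G 1)) = a := by simp [ξ.act_one]
  have h_smooth : ∀ᶠ v in 𝓝 (oneChart V G 1), ContMDiffAt 𝓘(ℝ, V) (totalModel V) ∞
      (fun v => ξ.act a ((oneChart V G).symm v)) v := by
    filter_upwards [(oneChart V G).open_target.mem_nhds (mem_chart_target V 1)] with v hv
    exact (ξ.contMDiffOn_act contMDiffOn_const contMDiffOn_chart_symm).contMDiffAt
      ((oneChart V G).open_target.mem_nhds hv)
  obtain ⟨O, huO, hO, h⟩ := exists_contDiffOn_twistedFib (T := T) (γ := γ) h_smooth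
    (by rwa [ha_eq]) (by rwa [ha_eq]) (by rwa [ha_eq])
  have h_deriv := hasFDerivAt_intervalIntegral_param
    (F := fun v t => twistedFib T γ (ξ.act a ((oneChart V G).symm v)) t)
    hO (h.of_le (by simp)) 0 (2 * Real.pi) (mem_of_mem_nhds huO)
  simpa only [(hasFDerivAt_twistedFib_act hγ ha hT _).fderiv, intervalIntegral.integral_const,
    sub_zero, ← averagedFib.eq_def] using h_deriv

end Average

section LocalEquivariantSection

variable {ξ : EquivariantPrincipalBundle V G} (T : ξ.LocalSection) (ε : ℤˣ)

/-- The parametrization of the total space by a base and a fibre coordinate that corresponds to a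
local section. -/
def localParam (q : ℂ × V) : ξ.E :=
  ξ.act (T.sec (stereo ε q.1)) ((oneChart V G).symm q.2)

variable {T ε}

theorem proj_localParam {q : ℂ × V} (hq : stereo ε q.1 ∈ T.base) :
    ξ.proj (localParam T ε q) = stereo ε q.1 := by
  rw [localParam, ξ.proj_act, T.proj_sec _ hq]

theorem localParam_coord {p : ξ.E} (hp : ξ.proj p ∈ T.base) (hp_pole : ξ.proj p ≠ pole (-ε))
    (hp_fib : T.fib p ∈ (oneChart V G).source) :
    localParam T ε (coord ε (ξ.proj p), oneChart V G (T.fib p)) = p := by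
  rw [localParam, stereo_coord hp_pole, (oneChart V G).left_inv hp_fib, T.act_sec_fib p hp]

variable [LieGroup 𝓘(ℝ, V) ∞ G]

theorem contMDiffAt_localParam {q : ℂ × V} (hq : stereo ε q.1 ∈ T.base)
    (hq' : q.2 ∈ (oneChart V G).target) :
    ContMDiffAt 𝓘(ℝ, ℂ × V) (totalModel V) ∞ (localParam T ε) q := by
  have h_sec : ContMDiffAt 𝓘(ℝ, ℂ × V) (totalModel V) ∞ (fun q : ℂ × V => T.sec (stereo ε q.1)) q :=
    (T.contMDiffAt_sec hq).comp q
      ((contMDiff_stereo ε).comp contDiff_fst.contMDiff).contMDiffAt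
  have h_chart : ContMDiffAt 𝓘(ℝ, ℂ × V) 𝓘(ℝ, V) ∞ (fun q : ℂ × V => (oneChart V G).symm q.2) q :=
    (contMDiffOn_chart_symm.contMDiffAt ((oneChart V G).open_target.mem_nhds hq')).comp q
      contDiff_snd.contMDiff.contMDiffAt
  exact ξ.act_smooth.contMDiffAt.comp q (h_sec.prodMk h_chart)

theorem eventually_contMDiffAt_localParam (hT : pole ε ∈ T.base) :
    ∀ᶠ q in 𝓝 ((0 : ℂ), oneChart V G 1),
      ContMDiffAt 𝓘(ℝ, ℂ × V) (totalModel V) ∞ (localParam T ε) q := by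
  have h_base : ∀ᶠ q : ℂ × V in 𝓝 (0, oneChart V G 1), stereo ε q.1 ∈ T.base :=
    (T.isOpen_base.preimage ((contMDiff_stereo ε).continuous.comp continuous_fst)).mem_nhds
      (by simpa [stereo_zero] using hT)
  have h_target : ∀ᶠ q : ℂ × V in 𝓝 (0, oneChart V G 1), q.2 ∈ (oneChart V G).target :=
    ((oneChart V G).open_target.preimage continuous_snd).mem_nhds (mem_chart_target V 1)
  filter_upwards [h_base, h_target] with q hq hq' using contMDiffAt_localParam hq hq'

variable [CompleteSpace V] {a : ξ.E} {γ : SmoothHom V G}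

theorem exists_graph_eq_zero_averagedFib (ha : ξ.proj a = pole ε) (hT : pole ε ∈ T.base)
    (hTa : T.sec (pole ε) = a) (hγ : ∀ A, ξ.rotAct A a = ξ.act a (γ A)) :
    ∃ ψ : ℂ → V, ψ 0 = oneChart V G 1 ∧ (∀ᶠ x in 𝓝 0, ContDiffAt ℝ ∞ ψ x) ∧
      ∀ᶠ q in 𝓝 ((0 : ℂ), oneChart V G 1),
        averagedFib T γ (localParam T ε q) = 0 ↔ ψ q.1 = q.2 := by
  have h_fib : T.fib a = 1 := hTa ▸ T.fib_sec hT
  have h_base : ξ.proj a ∈ T.base := ha ▸ hT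
  have h_param (v : V) : localParam T ε (0, v) = ξ.act a ((oneChart V G).symm v) := by
    rw [localParam, stereo_zero, hTa]
  have h_param_one : localParam T ε (0, oneChart V G 1) = a := by
    rw [h_param, (oneChart V G).left_inv (mem_chart_source V 1), ξ.act_one]
  have h_zero : averagedFib T γ (localParam T ε (0, oneChart V G 1)) = 0 := by
    rw [h_param_one, averagedFib_eq_zero h_fib hγ]
  have h_smooth : ∀ᶠ q in 𝓝 ((0 : ℂ), oneChart V G 1),
      ContDiffAt ℝ ∞ (fun q => averagedFib T γ (localParam T ε q)) q := by
    obtain ⟨O, hu, hO, h⟩ := exists_contDiffOn_twistedFib (T := T) (γ := γ)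
      (eventually_contMDiffAt_localParam hT) (by rwa [h_param_one]) (by rwa [h_param_one])
      (by rwa [h_param_one])
    filter_upwards [hu] with q hq
      using (contDiffOn_intervalIntegral_param hO h 0 (2 * Real.pi)).contDiffAt (hO.mem_nhds hq)
  have h_deriv : fderiv ℝ (fun q => averagedFib T γ (localParam T ε q)) (0, oneChart V G 1) ∘L
      .inr ℝ ℂ V = (2 * Real.pi) • .id ℝ V := by
    have h := (h_smooth.self_of_nhds.differentiableAt (by simp)).hasFDerivAt.comp
      (oneChart V G 1) (hasFDerivAt_prodMk_right (0 : ℂ) (oneChart V G 1))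
    refine h.unique ?_
    simpa only [Function.comp_def, h_param] using hasFDerivAt_averagedFib_act hγ h_base h_fib
  have h_inv : ((2 * Real.pi) • ContinuousLinearMap.id ℝ V).IsInvertible :=
    ⟨.smulLeft (Units.mk0 (2 * Real.pi) Real.two_pi_pos.ne'), rfl⟩
  have h := exists_implicit_contDiffAt h_smooth (h_deriv ▸ h_inv)
  simpa only [h_zero] using h

theorem exists_section_averagedFib_eq_zero (ha : ξ.proj a = pole ε) (hT : pole ε ∈ T.base)
    (hTa : T.sec (pole ε) = a) (hγ : ∀ A, ξ.rotAct A a = ξ.act a (γ A)) :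
    ∃ s : ℂ → ξ.E, s 0 = a ∧
      (∀ᶠ x in 𝓝 0, ContMDiffAt 𝓘(ℝ, ℂ) (totalModel V) ∞ s x ∧ ξ.proj (s x) = stereo ε x ∧
        averagedFib T γ (s x) = 0) ∧
      ∀ᶠ p in 𝓝 a, averagedFib T γ p = 0 → s (coord ε (ξ.proj p)) = p := by
  obtain ⟨ψ, hψ_zero, hψ, h_graph⟩ := exists_graph_eq_zero_averagedFib ha hT hTa hγ
  have h_base : ξ.proj a ∈ T.base := ha ▸ hT
  have h_fib : T.fib a = 1 := hTa ▸ T.fib_sec hT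
  have h_pole : ξ.proj a ≠ pole (-ε) := ha ▸ pole_ne_pole_neg ε
  have h_source : T.fib a ∈ (oneChart V G).source := h_fib ▸ mem_chart_source V 1
  have hψ_tendsto : Tendsto (fun x => (x, ψ x)) (𝓝 0) (𝓝 (0, oneChart V G 1)) := by
    simpa only [hψ_zero, ContinuousAt, id] using
      continuousAt_id.prodMk hψ.self_of_nhds.continuousAt
  refine ⟨fun x => localParam T ε (x, ψ x), ?_, ?_, ?_⟩
  · simp only [hψ_zero]
    rw [localParam, stereo_zero, hTa, (oneChart V G).left_inv (mem_chart_source V 1),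
      ξ.act_one]
  · have h_stereo : ∀ᶠ x in 𝓝 (0 : ℂ), stereo ε x ∈ T.base :=
      (T.isOpen_base.preimage (contMDiff_stereo ε).continuous).mem_nhds
        (by simpa only [mem_preimage, stereo_zero] using hT)
    filter_upwards [hψ, h_stereo, hψ_tendsto.eventually h_graph,
      hψ_tendsto.eventually (eventually_contMDiffAt_localParam hT)] with x hψx hx hx_graph hx_smooth
    exact ⟨hx_smooth.comp x (contMDiffAt_id.prodMk_space hψx.contMDiffAt), proj_localParam hx,
      hx_graph.2 rfl⟩
  · have h_coord : ContinuousAt (fun p => coord ε (ξ.proj p)) a :=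
      ((contMDiffOn_coord ε).contMDiffAt (isOpen_compl_singleton.mem_nhds h_pole)).continuousAt.comp
        ξ.continuous_proj.continuousAt
    have h_chart : ContinuousAt (fun p => oneChart V G (T.fib p)) a :=
      ((oneChart V G).continuousAt h_source).comp (T.contMDiffAt_fib h_base).continuousAt
    have h_tendsto : Tendsto (fun p => (coord ε (ξ.proj p), oneChart V G (T.fib p))) (𝓝 a)
        (𝓝 (0, oneChart V G 1)) := by
      simpa only [ContinuousAt, ha, coord_pole, h_fib] using h_coord.prodMk h_chart
    filter_upwards [h_tendsto.eventually h_graph,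
      (T.isOpen_base.preimage ξ.continuous_proj).mem_nhds h_base,
      ξ.continuous_proj.continuousAt.eventually (isOpen_compl_singleton.mem_nhds h_pole),
      (T.contMDiffAt_fib h_base).continuousAt.eventually
        ((oneChart V G).open_source.mem_nhds h_source)] with p hp_graph hp hp_pole hp_source hp_zero
    have hp_eq := localParam_coord hp hp_pole hp_source
    rwa [hp_graph.1 (by rwa [hp_eq])]

variable (ξ ε γ) in
/-- In the stereographic parametrization centred at a pole, `s` is near `x` a smooth section which
is equivariant up to the representation `γ` on the orbit of `x`. -/
structure IsEquivariantSectionAt (s : ℂ → ξ.E) (x : ℂ) : Prop where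
  contMDiffAt : ContMDiffAt 𝓘(ℝ, ℂ) (totalModel V) ∞ s x
  proj_eq : ξ.proj (s x) = stereo ε x
  rotAct_eq (z : Circle) : ξ.rotAct (rot z) (s x) = ξ.act (s (z * x)) (γ (rot z))

theorem exists_eventually_isEquivariantSectionAt (ha : ξ.proj a = pole ε)
    (hγ : ∀ A, ξ.rotAct A a = ξ.act a (γ A)) :
    ∃ s : ℂ → ξ.E, s 0 = a ∧ ∀ᶠ x in 𝓝 0, ξ.IsEquivariantSectionAt ε γ s x := by
  obtain ⟨T, hT, hTa⟩ := ξ.exists_localSection a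
  rw [ha] at hT hTa
  obtain ⟨s, hs_zero, hs, h_unique⟩ := exists_section_averagedFib_eq_zero ha hT hTa hγ
  have hs_tendsto : Tendsto s (𝓝 0) (𝓝 a) := hs_zero ▸ hs.self_of_nhds.1.continuousAt
  refine ⟨s, hs_zero, ?_⟩
  filter_upwards [hs, hs_tendsto.eventually (eventually_forall_twist_mem hγ h_unique)]
    with x ⟨hx_smooth, hx_proj, hx_zero⟩ hx_unique
  refine ⟨hx_smooth, hx_proj, fun z => ?_⟩
  have h := hx_unique z (by rw [averagedFib_twist, hx_zero, map_zero])
  rw [proj_twist, hx_proj, rotate_stereo, coord_stereo] at h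
  rw [h, ← rotAct_eq_act_twist]

end LocalEquivariantSection

end EquivariantPrincipalBundle

end Slice

/-! ### Framings -/

section Framings

variable {V : Type v} [NormedAddCommGroup V] [NormedSpace ℝ V]
  {G : Type u} [Group G] [TopologicalSpace G] [ChartedSpace V G]

namespace EquivariantPrincipalBundle

variable (ξ : EquivariantPrincipalBundle V G) (γ : SmoothHom V G)

/-- Twisted rotations spread a lift `τ` of a meridian, parametrized by the logarithm of the radius,
over the punctured plane. -/
def spread (τ : ℝ → ξ.E) (x : ℂ) : ξ.E :=
  ξ.twist γ (ang x) (τ (Real.log ‖x‖))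

variable {ξ γ} {ε : ℤˣ} {s : ℂ → ξ.E} {τ : ℝ → ξ.E}

theorem spread_exp (t : ℝ) : ξ.spread γ τ (Real.exp t) = τ t := by
  rw [spread, ang_ofReal (Real.exp_pos t), twist_one, Complex.norm_real, Real.norm_eq_abs,
    Real.abs_exp, Real.log_exp]

theorem proj_spread (hτ : ∀ t, ξ.proj (τ t) = stereo ε (Real.exp t)) {x : ℂ} (hx : x ≠ 0) :
    ξ.proj (ξ.spread γ τ x) = stereo ε x := by
  rw [spread, proj_twist, hτ, rotate_stereo, Real.exp_log (norm_pos_iff.2 hx), ang_mul_norm hx]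

theorem rotAct_spread (z : Circle) {x : ℂ} (hx : x ≠ 0) :
    ξ.rotAct (rot z) (ξ.spread γ τ x) = ξ.act (ξ.spread γ τ (z * x)) (γ (rot z)) := by
  rw [rotAct_eq_act_twist (γ := γ), spread, spread, ang_circle_mul z hx, norm_mul, Circle.norm_coe,
    one_mul, twist_mul]

theorem spread_eq {x : ℂ} (hx : x ≠ 0) (hτ : τ (Real.log ‖x‖) = s ‖x‖)
    (hs : ξ.IsEquivariantSectionAt ε γ s ‖x‖) : ξ.spread γ τ x = s x := by
  rw [spread, twist, hτ, hs.rotAct_eq, ang_mul_norm hx, ← ξ.act_mul, mul_inv_cancel, ξ.act_one]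

theorem contMDiffOn_spread [LieGroup 𝓘(ℝ, V) ∞ G]
    (hτ : ContMDiff 𝓘(ℝ, ℝ) (totalModel V) ∞ τ) :
    ContMDiffOn 𝓘(ℝ, ℂ) (totalModel V) ∞ (ξ.spread γ τ) {0}ᶜ := by
  have h_log : ContDiffOn ℝ ∞ (fun x : ℂ => Real.log ‖x‖) {0}ᶜ :=
    (contDiffOn_id.norm ℝ fun x hx => hx).log fun x hx => norm_ne_zero_iff.2 hx
  exact contMDiffOn_twist contMDiffOn_ang (hτ.comp_contMDiffOn h_log.contMDiffOn)

theorem eventually_spread_eq (hs : ∀ᶠ x in 𝓝 0, ξ.IsEquivariantSectionAt ε γ s x)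
    (hτ : ∀ᶠ t in atBot, τ t = s (Real.exp t)) : ∀ᶠ x in 𝓝[≠] 0, ξ.spread γ τ x = s x := by
  have h_norm : Tendsto (fun x : ℂ => ((‖x‖ : ℝ) : ℂ)) (𝓝[≠] 0) (𝓝 0) := by
    have h : Continuous fun x : ℂ => ((‖x‖ : ℝ) : ℂ) := by fun_prop
    simpa using (h.tendsto 0).mono_left nhdsWithin_le_nhds
  have h_log : Tendsto (fun x : ℂ => Real.log ‖x‖) (𝓝[≠] 0) atBot :=
    Real.tendsto_log_nhdsGT_zero.comp tendsto_norm_nhdsNE_zero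
  filter_upwards [h_norm.eventually hs, h_log.eventually hτ, self_mem_nhdsWithin] with x hx hτx hx0
  rw [Real.exp_log (norm_pos_iff.2 hx0)] at hτx
  exact spread_eq hx0 hτx hx

theorem exists_forall_isEquivariantSectionAt [LieGroup 𝓘(ℝ, V) ∞ G]
    (hs : ∀ᶠ x in 𝓝 0, ξ.IsEquivariantSectionAt ε γ s x)
    (hτ : ContMDiff 𝓘(ℝ, ℝ) (totalModel V) ∞ τ)
    (hτ_proj : ∀ t, ξ.proj (τ t) = stereo ε (Real.exp t))
    (hτ_eq : ∀ᶠ t in atBot, τ t = s (Real.exp t)) :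
    ∃ S : ℂ → ξ.E, (∀ x, ξ.IsEquivariantSectionAt ε γ S x) ∧ ∀ t : ℝ, S (Real.exp t) = τ t := by
  let S : ℂ → ξ.E := Function.update (ξ.spread γ τ) 0 (s 0)
  have hS_zero : S 0 = s 0 := Function.update_self ..
  have hS_ne {x : ℂ} (hx : x ≠ 0) : S x = ξ.spread γ τ x := Function.update_of_ne hx ..
  have hS_near : S =ᶠ[𝓝 0] s := by
    filter_upwards [eventually_nhdsWithin_iff.1 (eventually_spread_eq hs hτ_eq)] with x hx
    rcases eq_or_ne x 0 with rfl | hx0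
    · exact hS_zero
    · exact (hS_ne hx0).trans (hx hx0)
  refine ⟨S, fun x => ?_, fun t => ?_⟩
  · rcases eq_or_ne x 0 with rfl | hx
    · have h := hs.self_of_nhds
      refine ⟨h.contMDiffAt.congr_of_eventuallyEq hS_near, hS_zero ▸ h.proj_eq, fun z => ?_⟩
      simpa only [mul_zero, hS_zero] using h.rotAct_eq z
    · have hx_nhds : ({0}ᶜ : Set ℂ) ∈ 𝓝 x := isOpen_compl_singleton.mem_nhds hx
      refine ⟨((contMDiffOn_spread (γ := γ) hτ).contMDiffAt hx_nhds).congr_of_eventuallyEq ?_,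
        (hS_ne hx).symm ▸ proj_spread hτ_proj hx, fun z => ?_⟩
      · filter_upwards [hx_nhds] with y hy using hS_ne hy
      · rw [hS_ne hx, hS_ne (mul_ne_zero z.coe_ne_zero hx), rotAct_spread z hx]
  · rw [hS_ne (Complex.ofReal_ne_zero.2 (Real.exp_ne_zero t)), spread_exp]

variable (ξ) in
/-- Smooth sections over the complements of the poles, `s ε` in the stereographic coordinate centred
at `pole ε`, equivariant up to the representations `γ`, which agree on a meridian. Inversion of the
radius relates the two coordinates. -/
structure Framing (γ : ℤˣ → SmoothHom V G) where
  s : ℤˣ → ℂ → ξ.E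
  isEquivariantSectionAt : ∀ ε x, ξ.IsEquivariantSectionAt ε (γ ε) (s ε) x
  agree : ∀ t : ℝ, s (-1) (Real.exp t) = s 1 (Real.exp (-t))

theorem exists_meridian_lift [LieGroup 𝓘(ℝ, V) ∞ G] [ConnectedSpace G] {γ : ℤˣ → SmoothHom V G}
    {s : ℤˣ → ℂ → ξ.E} (hs : ∀ ε, ∀ᶠ x in 𝓝 0, ξ.IsEquivariantSectionAt ε (γ ε) (s ε) x) :
    ∃ σ : ℝ → ξ.E, ContMDiff 𝓘(ℝ, ℝ) (totalModel V) ∞ σ ∧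
      (∀ t, ξ.proj (σ t) = stereo (-1) (Real.exp t)) ∧
      (∀ᶠ t in atBot, σ t = s (-1) (Real.exp t)) ∧ ∀ᶠ t in atBot, σ (-t) = s 1 (Real.exp t) := by
  have h_exp : ContMDiff 𝓘(ℝ, ℝ) 𝓘(ℝ, ℂ) ∞ fun t : ℝ => ((Real.exp t : ℝ) : ℂ) :=
    (Complex.ofRealCLM.contDiff.comp Real.contDiff_exp).contMDiff
  have h_tendsto : Tendsto (fun t : ℝ => ((Real.exp t : ℝ) : ℂ)) atBot (𝓝 0) :=
    (Complex.continuous_ofReal.tendsto' 0 0 Complex.ofReal_zero).comp Real.tendsto_exp_atBot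
  choose t₀ ht₀ using fun ε => eventually_atBot.1 (h_tendsto.eventually (hs ε))
  have h_south : ξ.IsLiftOn (fun t => stereo (-1) (Real.exp t)) (fun t => s (-1) (Real.exp t))
      (Iio (t₀ (-1))) :=
    ⟨fun t ht => ((ht₀ _ t ht.le).contMDiffAt.comp t h_exp.contMDiffAt).contMDiffWithinAt,
      fun t ht => (ht₀ _ t ht.le).proj_eq⟩
  have h_north : ξ.IsLiftOn (fun t => stereo (-1) (Real.exp t)) (fun t => s 1 (Real.exp (-t)))
      (Ioi (-t₀ 1)) :=
    ⟨fun t ht => ((ht₀ 1 (-t) (neg_lt.1 ht).le).contMDiffAt.comp t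
        (h_exp.comp contDiff_neg.contMDiff).contMDiffAt).contMDiffWithinAt,
      fun t ht => (ht₀ 1 (-t) (neg_lt.1 ht).le).proj_eq.trans (stereo_neg_exp 1 t).symm⟩
  obtain ⟨σ, ⟨hσ, hσ_proj⟩, hσ_bot, hσ_top⟩ := PrincipalBundle.exists_isLiftOn_univ
    ((contMDiff_stereo _).comp h_exp) h_south h_north
  refine ⟨σ, contMDiffOn_univ.1 hσ, fun t => hσ_proj t (mem_univ t), hσ_bot, ?_⟩
  simpa only [neg_neg] using tendsto_neg_atBot_atTop.eventually hσ_top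

theorem nonempty_framing [LieGroup 𝓘(ℝ, V) ∞ G] [CompleteSpace V] [ConnectedSpace G]
    {γ : ℤˣ → SmoothHom V G} {a : ℤˣ → ξ.E} (ha : ∀ ε, ξ.proj (a ε) = pole ε)
    (hγ : ∀ ε A, ξ.rotAct A (a ε) = ξ.act (a ε) (γ ε A)) :
    Nonempty (ξ.Framing γ) := by
  choose s _ hs using fun ε => exists_eventually_isEquivariantSectionAt (ha ε) (hγ ε)
  obtain ⟨σ, hσ, hσ_proj, hσ_south, hσ_north⟩ := exists_meridian_lift hs
  obtain ⟨S, hS, hS_exp⟩ := exists_forall_isEquivariantSectionAt (hs (-1)) hσ hσ_proj hσ_south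
  obtain ⟨N, hN, hN_exp⟩ := exists_forall_isEquivariantSectionAt (hs 1)
    (τ := fun t => σ (-t)) (hσ.comp contDiff_neg.contMDiff)
    (fun t => by rw [hσ_proj, stereo_neg_exp, neg_neg]) hσ_north
  refine ⟨fun ε => if ε = 1 then N else S, fun ε => ?_, fun t => ?_⟩
  · rcases Int.units_eq_one_or ε with rfl | rfl <;> simpa
  · rw [if_neg (by decide), if_pos rfl, hS_exp, hN_exp, neg_neg]

end EquivariantPrincipalBundle

end Framings

section Injectivity

variable {V : Type v} [NormedAddCommGroup V] [NormedSpace ℝ V]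
  {G : Type u} [Group G] [TopologicalSpace G] [ChartedSpace V G]

theorem exists_ne_pole_neg (x : S2) : ∃ ε, x ≠ pole (-ε) := by
  by_cases h : x = pole (-1)
  · exact ⟨-1, h ▸ pole_ne_pole_neg (-1)⟩
  · exact ⟨1, h⟩

theorem stereo_injective (ε : ℤˣ) : Function.Injective (stereo ε) :=
  Function.LeftInverse.injective (coord_stereo ε)

theorem exists_polar_of_stereo_eq_stereo_neg {ε : ℤˣ} {x y : ℂ} (h : stereo (-ε) x = stereo ε y) :
    ∃ (z : Circle) (t : ℝ), x = z * Real.exp t ∧ y = z * Real.exp (-t) := by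
  have hx : x ≠ 0 := by
    rintro rfl
    rw [stereo_zero] at h
    exact stereo_ne_pole_neg ε y h.symm
  have hx_polar : x = ang x * Real.exp (Real.log ‖x‖) := by
    rw [Real.exp_log (norm_pos_iff.2 hx), ang_mul_norm hx]
  refine ⟨ang x, Real.log ‖x‖, hx_polar, stereo_injective ε ?_⟩
  rw [← stereo_neg_mul_exp, ← hx_polar, h]

namespace EquivariantPrincipalBundle

namespace Framing

variable {ξ ξ' : EquivariantPrincipalBundle V G} {γ : ℤˣ → SmoothHom V G}
  (f : ξ.Framing γ) (f' : ξ'.Framing γ)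

theorem contMDiff_s (ε : ℤˣ) : ContMDiff 𝓘(ℝ, ℂ) (totalModel V) ∞ (f.s ε) := fun x =>
  (f.isEquivariantSectionAt ε x).contMDiffAt

theorem proj_s (ε : ℤˣ) (x : ℂ) : ξ.proj (f.s ε x) = stereo ε x :=
  (f.isEquivariantSectionAt ε x).proj_eq

theorem rotAct_s (ε : ℤˣ) (z : Circle) (x : ℂ) :
    ξ.rotAct (rot z) (f.s ε x) = ξ.act (f.s ε (z * x)) (γ ε (rot z)) :=
  (f.isEquivariantSectionAt ε x).rotAct_eq z

theorem s_neg_exp (ε : ℤˣ) (t : ℝ) : f.s (-ε) (Real.exp t) = f.s ε (Real.exp (-t)) := by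
  rcases Int.units_eq_one_or ε with rfl | rfl
  · exact f.agree t
  · rw [neg_neg, f.agree, neg_neg]

theorem s_neg_mul_exp (ε : ℤˣ) (z : Circle) (t : ℝ) :
    f.s (-ε) (z * Real.exp t) =
      ξ.act (f.s ε (z * Real.exp (-t))) (γ ε (rot z) * (γ (-ε) (rot z))⁻¹) := by
  have h := congrArg (ξ.rotAct (rot z)) (f.s_neg_exp ε t)
  rw [f.rotAct_s, f.rotAct_s] at h
  rw [ξ.act_mul, ← h, ← ξ.act_mul, mul_inv_cancel, ξ.act_one]

theorem exists_eq_act {ε : ℤˣ} {p : ξ.E} (hp : ξ.proj p ≠ pole (-ε)) :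
    ∃ g, p = ξ.act (f.s ε (coord ε (ξ.proj p))) g :=
  ξ.exists_act_eq (by rw [f.proj_s, stereo_coord hp])

theorem exists_eq (p : ξ.E) : ∃ ε x g, p = ξ.act (f.s ε x) g := by
  obtain ⟨ε, hε⟩ := exists_ne_pole_neg (ξ.proj p)
  obtain ⟨g, hg⟩ := f.exists_eq_act hε
  exact ⟨ε, _, g, hg⟩

theorem act_s_eq_act_s {ε δ : ℤˣ} {x y : ℂ} {g h : G}
    (heq : ξ.act (f.s ε x) g = ξ.act (f.s δ y) h) :
    ξ'.act (f'.s ε x) g = ξ'.act (f'.s δ y) h := by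
  have h_stereo : stereo ε x = stereo δ y := by
    rw [← f.proj_s, ← f.proj_s, ← ξ.proj_act _ g, heq, ξ.proj_act]
  rcases eq_or_ne ε δ with rfl | hε
  · obtain rfl := stereo_injective ε h_stereo
    rw [ξ.act_left_cancel heq]
  · obtain rfl : ε = -δ := Int.units_ne_iff_eq_neg.1 hε
    obtain ⟨z, t, rfl, rfl⟩ := exists_polar_of_stereo_eq_stereo_neg h_stereo
    rw [f.s_neg_mul_exp, ← ξ.act_mul] at heq
    rw [f'.s_neg_mul_exp, ← ξ'.act_mul, ξ.act_left_cancel heq]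

theorem exists_map (p : ξ.E) :
    ∃ p' : ξ'.E, ∀ ε x g, p = ξ.act (f.s ε x) g → p' = ξ'.act (f'.s ε x) g := by
  obtain ⟨ε, x, g, rfl⟩ := f.exists_eq p
  exact ⟨_, fun _ _ _ h => f.act_s_eq_act_s f' h⟩

/-- The `G`-equivariant map of total spaces which takes one framing to another. -/
def map (p : ξ.E) : ξ'.E :=
  (f.exists_map f' p).choose

theorem map_act (ε : ℤˣ) (x : ℂ) (g : G) :
    f.map f' (ξ.act (f.s ε x) g) = ξ'.act (f'.s ε x) g :=
  (f.exists_map f' _).choose_spec ε x g rfl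

theorem map_map (p : ξ.E) : f'.map f (f.map f' p) = p := by
  obtain ⟨ε, x, g, rfl⟩ := f.exists_eq p
  rw [map_act, map_act]

theorem contMDiff_map [LieGroup 𝓘(ℝ, V) ∞ G] :
    ContMDiff (totalModel V) (totalModel V) ∞ (f.map f') := by
  intro p
  obtain ⟨ε, hε⟩ := exists_ne_pole_neg (ξ.proj p)
  let U : Set ξ.E := ξ.proj ⁻¹' {pole (-ε)}ᶜ
  have hU : IsOpen U := isOpen_compl_singleton.preimage ξ.continuous_proj
  have h_coord : ContMDiffOn (totalModel V) 𝓘(ℝ, ℂ) ∞ (fun q => coord ε (ξ.proj q)) U :=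
    (contMDiffOn_coord ε).comp ξ.proj_smooth.contMDiffOn fun q hq => hq
  choose! k hk using fun q (hq : q ∈ U) => f.exists_eq_act hq
  have hk_smooth : ContMDiffOn (totalModel V) 𝓘(ℝ, V) ∞ k U :=
    ξ.contMDiffOn_of_act_eq ((f.contMDiff_s ε).comp_contMDiffOn h_coord) contMDiffOn_id hk
  have h_act := ξ'.contMDiffOn_act ((f'.contMDiff_s ε).comp_contMDiffOn h_coord) hk_smooth
  refine (h_act.congr fun q hq => ?_).contMDiffAt (hU.mem_nhds hε)
  conv_lhs => rw [hk q hq]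
  exact f.map_act f' ε _ _

theorem isomorphic [LieGroup 𝓘(ℝ, V) ∞ G] (f : ξ.Framing γ) (f' : ξ'.Framing γ) :
    Isomorphic ξ ξ' := by
  refine ⟨⟨⟨f.map f', f'.map f, f.map_map f', f'.map_map f⟩, f.contMDiff_map f',
    f'.contMDiff_map f⟩, fun p g => ?_, fun A p => ?_, fun p => ?_⟩
  · obtain ⟨ε, x, h, rfl⟩ := f.exists_eq p
    change f.map f' _ = ξ'.act (f.map f' _) g
    rw [← ξ.act_mul, map_act, map_act, ξ'.act_mul]
  · obtain ⟨ε, x, h, rfl⟩ := f.exists_eq p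
    obtain ⟨z, rfl⟩ := rot_surjective A
    change f.map f' _ = ξ'.rotAct (rot z) (f.map f' _)
    rw [map_act, ξ.rotAct_act, f.rotAct_s, ← ξ.act_mul, map_act, ξ'.rotAct_act, f'.rotAct_s,
      ξ'.act_mul]
  · obtain ⟨ε, x, h, rfl⟩ := f.exists_eq p
    change ξ'.proj (f.map f' _) = _
    rw [map_act, ξ'.proj_act, ξ.proj_act, f.proj_s, f'.proj_s]

end Framing

theorem exists_rotAct_eq_of_isotropyClass_eq [LieGroup 𝓘(ℝ, V) ∞ G]
    {ξ : EquivariantPrincipalBundle V G} {x : S2} (hx : ∀ A, rotate A x = x) {α : SmoothHom V G}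
    (h : ξ.isotropyClass x hx = Quotient.mk (conjSetoid V G) α) :
    ∃ a, ξ.proj a = x ∧ ∀ A, ξ.rotAct A a = ξ.act a (α A) := by
  obtain ⟨a, ha⟩ := ξ.exists_point x
  have ha_fixed : ∀ A, rotate A (ξ.proj a) = ξ.proj a := by rwa [ha]
  rw [ξ.isotropyClass_eq x hx a ha _ (ξ.isotropyRep_spec a ha_fixed)] at h
  obtain ⟨g, hg⟩ := Quotient.exact h
  refine ⟨ξ.act a g⁻¹, by rw [ξ.proj_act, ha], fun A => ?_⟩
  rw [ξ.rotAct_act, ξ.isotropyRep_spec a ha_fixed, ← ξ.act_mul, ← ξ.act_mul, hg A]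
  congr 1
  group

theorem nonempty_framing_of_J_eq [LieGroup 𝓘(ℝ, V) ∞ G] [CompleteSpace V] [ConnectedSpace G]
    {ξ : EquivariantPrincipalBundle V G} {γ : ℤˣ → SmoothHom V G}
    (h : J (Quotient.mk (isoSetoid V G) ξ) =
      (Quotient.mk (conjSetoid V G) (γ (-1)), Quotient.mk (conjSetoid V G) (γ 1))) :
    Nonempty (ξ.Framing γ) := by
  have h_pole (ε : ℤˣ) : ∃ a, ξ.proj a = pole ε ∧ ∀ A, ξ.rotAct A a = ξ.act a (γ ε A) := by
    rcases Int.units_eq_one_or ε with rfl | rfl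
    · rw [pole_one]
      exact exists_rotAct_eq_of_isotropyClass_eq rotate_northPole (congrArg Prod.snd h)
    · rw [pole_neg_one]
      exact exists_rotAct_eq_of_isotropyClass_eq rotate_southPole (congrArg Prod.fst h)
  choose a ha hγ using h_pole
  exact nonempty_framing ha hγ

end EquivariantPrincipalBundle

/-- The family of representations, indexed by the poles, with the value `α` at the south pole and
`β` at the north pole. -/
def repPair (α β : SmoothHom V G) (ε : ℤˣ) : SmoothHom V G := if ε = 1 then β else α

theorem J_injective [LieGroup 𝓘(ℝ, V) ∞ G] [CompleteSpace V] [ConnectedSpace G] :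
    Function.Injective (J (V := V) (G := G)) := by
  intro c c' h
  induction c using Quotient.inductionOn with | _ ξ
  induction c' using Quotient.inductionOn with | _ ξ'
  obtain ⟨α, hα⟩ := Quotient.exists_rep (J (Quotient.mk (isoSetoid V G) ξ)).1
  obtain ⟨β, hβ⟩ := Quotient.exists_rep (J (Quotient.mk (isoSetoid V G) ξ)).2
  have hξ : J (Quotient.mk (isoSetoid V G) ξ) =
      (Quotient.mk (conjSetoid V G) (repPair α β (-1)),
        Quotient.mk (conjSetoid V G) (repPair α β 1)) :=
    Prod.ext hα.symm hβ.symm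
  obtain ⟨f⟩ := EquivariantPrincipalBundle.nonempty_framing_of_J_eq hξ
  obtain ⟨f'⟩ := EquivariantPrincipalBundle.nonempty_framing_of_J_eq (h.symm.trans hξ)
  exact Quotient.sound (f.isomorphic f')

end Injectivity

/-! ### Lifts of the collapse map -/

section Boundary

open scoped unitInterval

theorem ang_real_mul {r : ℝ} (hr : 0 < r) (x : ℂ) : ang (r * x) = ang x := by
  rcases eq_or_ne x 0 with rfl | hx
  · rw [mul_zero]
  · have hr' : (r : ℂ) ≠ 0 := Complex.ofReal_ne_zero.2 hr.ne'
    ext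
    rw [ang_coe hx, ang_coe (mul_ne_zero hr' hx), norm_mul, Complex.norm_real,
      Real.norm_of_nonneg hr.le, Complex.ofReal_mul, mul_div_mul_left _ _ hr']

theorem ang_coe_circle (z : Circle) : ang z = z := by
  ext
  rw [ang_coe z.coe_ne_zero, z.norm_coe, Complex.ofReal_one, div_one]

theorem collapse_ne_pole_neg_one {w : Disc} (hw : ‖w.1‖ < 1) : collapse w ≠ pole (-1) := by
  rw [Ne, eq_pole_iff, sgn_neg, sgn_one]
  change ¬ (1 - 2 * ‖w.1‖ ^ 2 = -1)
  nlinarith [norm_nonneg w.1]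

theorem collapse_ne_pole_one {w : Disc} (hw : w.1 ≠ 0) : collapse w ≠ pole 1 := by
  rw [Ne, eq_pole_iff, sgn_one]
  change ¬ (1 - 2 * ‖w.1‖ ^ 2 = 1)
  have := norm_pos_iff.2 hw
  nlinarith

theorem collapse_of_norm_eq_one {w : Disc} (hw : ‖w.1‖ = 1) : collapse w = pole (-1) := by
  rw [eq_pole_iff, sgn_neg, sgn_one]
  change 1 - 2 * ‖w.1‖ ^ 2 = -1
  rw [hw]
  norm_num

theorem continuousAt_coord_collapse {ε : ℤˣ} {w : Disc} (hw : collapse w ≠ pole (-ε)) :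
    ContinuousAt (fun w => coord ε (collapse w)) w :=
  ContinuousAt.comp (g := coord ε)
    ((contMDiffOn_coord ε).continuousOn.continuousAt (isOpen_compl_singleton.mem_nhds hw))
    collapse.continuous.continuousAt

theorem coord_one_collapse (w : Disc) :
    coord 1 (collapse w) = ((√(1 - ‖w.1‖ ^ 2) / (1 - ‖w.1‖ ^ 2) : ℝ) : ℂ) * w.1 := by
  have h_height : 1 + sgn 1 * (1 - 2 * ‖w.1‖ ^ 2) = 2 * (1 - ‖w.1‖ ^ 2) := by
    rw [sgn_one]
    ring
  have h_cancel (c : ℝ) : 2 * √(1 - ‖w.1‖ ^ 2) * c / (2 * (1 - ‖w.1‖ ^ 2)) =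
      √(1 - ‖w.1‖ ^ 2) / (1 - ‖w.1‖ ^ 2) * c := by
    rw [mul_assoc, mul_div_mul_left _ _ two_ne_zero, mul_div_right_comm]
  apply Complex.ext
  · rw [Complex.re_ofReal_mul, ← h_cancel, ← h_height]
    rfl
  · rw [Complex.im_ofReal_mul, ← h_cancel, ← h_height]
    rfl

theorem ang_coord_one_collapse {w : Disc} (hw : ‖w.1‖ < 1) :
    ang (coord 1 (collapse w)) = ang w.1 := by
  have h : 0 < 1 - ‖w.1‖ ^ 2 := by nlinarith [norm_nonneg w.1]
  rw [coord_one_collapse, ang_real_mul (div_pos (Real.sqrt_pos.2 h) h)]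

theorem circleLoop_zero : circleLoop 0 = 1 := by simp [circleLoop]

theorem circleLoop_one : circleLoop 1 = 1 := by simp [circleLoop]

/-- Polar coordinates on the disc, with the angle in `[0, 1]`. -/
def discPolar : C(I × I, Disc) where
  toFun x := ⟨(x.1 : ℝ) * (circleLoop x.2 : ℂ), by
    rw [mem_closedBall_zero_iff, norm_mul, Circle.norm_coe, mul_one, Complex.norm_real,
      Real.norm_of_nonneg x.1.2.1]
    exact x.1.2.2⟩
  continuous_toFun := by
    have := continuous_circleLoop
    fun_prop

theorem discPolar_zero_left (t : I) : discPolar (0, t) = discPolar (0, 0) :=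
  Subtype.ext (by simp [discPolar])

theorem discPolar_one_left (t : I) : discPolar (1, t) = discBoundary (circleLoop t) :=
  Subtype.ext (by simp [discPolar, discBoundary])

theorem discPolar_one_right (s : I) : discPolar (s, 1) = discPolar (s, 0) :=
  Subtype.ext (by simp only [discPolar, ContinuousMap.coe_mk, circleLoop_zero, circleLoop_one])

section Homotopy

variable {G : Type*} [Group G] [TopologicalSpace G] [IsTopologicalGroup G] {p q : Path (1 : G) 1}

theorem homotopic_of_eq_inv_mul_mul (K : C(I × I, G)) (hK_left : ∀ t, K (0, t) = 1)
    (hK_right : ∀ s, K (s, 1) = K (s, 0)) (hq : ∀ t, q t = (K (1, 0))⁻¹ * p t * K (1, t)) :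
    p.Homotopic q := by
  refine ⟨⟨⟨⟨fun x => (K (x.1, 0))⁻¹ * p x.2 * K x, ?_⟩, fun t => ?_, fun t => ?_⟩, ?_⟩⟩
  · have h_zero : Continuous fun x : I × I => K (x.1, 0) := by fun_prop
    exact (h_zero.inv.mul (p.continuous.comp continuous_snd)).mul K.continuous
  · simp [hK_left]
  · simp [hq]
  · rintro s t (rfl | rfl)
    · simp
    · simp [hK_right]

-- The cone of `h` is a homotopy to a constant loop, which a path in `G` moves to the unit.
theorem homotopic_of_extends_to_disc [PathConnectedSpace G] (h : C(Disc, G))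
    (hq : ∀ t, q t = (h (discBoundary 1))⁻¹ * p t * h (discBoundary (circleLoop t))) :
    p.Homotopic q := by
  let κ : Path 1 (h (discPolar (0, 0))) := PathConnectedSpace.somePath _ _
  let K : C(I × I, G) :=
    ⟨fun x => κ x.1 * (h (discPolar (0, 0)))⁻¹ * h (discPolar x), by fun_prop⟩
  refine homotopic_of_eq_inv_mul_mul K (fun t => ?_) (fun s => ?_) fun t => ?_
  · simp [K, discPolar_zero_left]
  · simp [K, discPolar_one_right]
  · simp [K, discPolar_one_left, circleLoop_zero, hq]

end Homotopy

variable {V : Type v} [NormedAddCommGroup V] [NormedSpace ℝ V]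
  {G : Type u} [Group G] [TopologicalSpace G] [ChartedSpace V G]

theorem PrincipalBundle.subsingleton_boundary [LieGroup 𝓘(ℝ, V) ∞ G] [ConnectedSpace G]
    (η : PrincipalBundle V G) (f : C(Disc, S2)) : (η.boundary f).Subsingleton := by
  have := topologicalGroup_of_lieGroup 𝓘(ℝ, V) ∞ (G := G)
  have := ChartedSpace.locallyPathConnectedSpace V G
  have : PathConnectedSpace G := pathConnectedSpace_iff_connectedSpace.2 inferInstance
  rintro _ ⟨a, F, p, hF, hp, rfl⟩ _ ⟨b, F', q, hF', hq, rfl⟩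
  choose k hk using fun w => η.exists_act_eq ((hF' w).trans (hF w).symm)
  let h : C(Disc, G) := ⟨k, η.continuous_of_act_eq F.continuous F'.continuous hk⟩
  have hb : b = η.act a (k (discBoundary 1)) := by
    have hq_zero := hq 0
    have hp_zero := hp 0
    rw [circleLoop_zero, Path.source, η.act_one] at hq_zero hp_zero
    rw [← hq_zero, ← hp_zero, hk]
  have h_loop (t : I) : k (discBoundary 1) * q t = p t * k (discBoundary (circleLoop t)) :=
    η.act_left_cancel (by rw [η.act_mul, ← hb, ← hq, hk, hp, ← η.act_mul])
  congr 1
  refine Quotient.sound (homotopic_of_extends_to_disc h fun t => ?_)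
  change q t = (k (discBoundary 1))⁻¹ * p t * k (discBoundary (circleLoop t))
  rw [mul_assoc, ← h_loop, inv_mul_cancel_left]

namespace EquivariantPrincipalBundle

variable {ξ : EquivariantPrincipalBundle V G}

namespace Framing

variable {γ : ℤˣ → SmoothHom V G} (f : ξ.Framing γ)

open Classical in
/-- The lift of the collapse map defined by a framing. -/
def discLift (w : Disc) : ξ.E :=
  if ‖w.1‖ < 1 then f.s 1 (coord 1 (collapse w))
  else ξ.act (f.s (-1) 0) (γ (-1) (rot (ang w.1)) * (γ 1 (rot (ang w.1)))⁻¹)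

theorem discLift_of_norm_lt_one {w : Disc} (hw : ‖w.1‖ < 1) :
    f.discLift w = f.s 1 (coord 1 (collapse w)) := if_pos hw

theorem discLift_of_ne_zero {w : Disc} (hw : w.1 ≠ 0) :
    f.discLift w = ξ.act (f.s (-1) (coord (-1) (collapse w)))
      (γ (-1) (rot (ang w.1)) * (γ 1 (rot (ang w.1)))⁻¹) := by
  by_cases h : ‖w.1‖ < 1
  · have h_stereo : stereo (- -1) (coord 1 (collapse w)) =
        stereo (-1) (coord (-1) (collapse w)) := by
      rw [neg_neg, stereo_coord (collapse_ne_pole_neg_one h),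
        stereo_coord (by simpa only [neg_neg] using collapse_ne_pole_one hw)]
    obtain ⟨z, t, h_one, h_neg_one⟩ := exists_polar_of_stereo_eq_stereo_neg h_stereo
    have hz : z = ang w.1 := by
      rw [← ang_coord_one_collapse h, h_one, mul_comm, ang_real_mul (Real.exp_pos t),
        ang_coe_circle]
    have h_s := f.s_neg_mul_exp (-1) z t
    rwa [neg_neg, ← h_one, ← h_neg_one, hz, ← f.discLift_of_norm_lt_one h] at h_s
  · have hw_norm : ‖w.1‖ = 1 := le_antisymm (mem_closedBall_zero_iff.1 w.2) (not_lt.1 h)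
    rw [discLift, if_neg h, collapse_of_norm_eq_one hw_norm, coord_pole]

theorem continuous_discLift [LieGroup 𝓘(ℝ, V) ∞ G] : Continuous f.discLift := by
  have := topologicalGroup_of_lieGroup 𝓘(ℝ, V) ∞ (G := G)
  rw [continuous_iff_continuousAt]
  intro w
  rcases eq_or_ne w.1 0 with hw | hw
  · have hw_norm : ‖w.1‖ < 1 := by simp [hw]
    have hU : {w : Disc | ‖w.1‖ < 1} ∈ 𝓝 w :=
      (isOpen_lt (continuous_norm.comp continuous_subtype_val) continuous_const).mem_nhds hw_norm
    refine ((f.contMDiff_s 1).continuous.continuousAt.comp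
      (continuousAt_coord_collapse (collapse_ne_pole_neg_one hw_norm))).congr ?_
    filter_upwards [hU] with y hy using (f.discLift_of_norm_lt_one hy).symm
  · have hU : {w : Disc | w.1 ≠ 0} ∈ 𝓝 w :=
      (isOpen_compl_singleton.preimage continuous_subtype_val).mem_nhds hw
    have h_coord : ContinuousAt (fun w => coord (-1) (collapse w)) w :=
      continuousAt_coord_collapse (by simpa only [neg_neg] using collapse_ne_pole_one hw)
    have h_rot : ContinuousAt (fun w : Disc => rot (ang w.1)) w :=
      contMDiff_rot.continuous.continuousAt.comp
        ((contMDiffOn_ang.continuousOn.continuousAt (isOpen_compl_singleton.mem_nhds hw)).comp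
          continuous_subtype_val.continuousAt)
    have h_γ (ε : ℤˣ) : ContinuousAt (fun w : Disc => γ ε (rot (ang w.1))) w :=
      (map_continuous (γ ε)).continuousAt.comp h_rot
    refine (ξ.continuous_act.continuousAt.comp
      (((f.contMDiff_s (-1)).continuous.continuousAt.comp h_coord).prodMk
        ((h_γ (-1)).mul (h_γ 1).inv))).congr ?_
    filter_upwards [hU] with y hy using (f.discLift_of_ne_zero hy).symm

theorem proj_discLift (w : Disc) : ξ.proj (f.discLift w) = collapse w := by
  rcases eq_or_ne w.1 0 with hw | hw
  · have hw_norm : ‖w.1‖ < 1 := by simp [hw]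
    rw [f.discLift_of_norm_lt_one hw_norm, f.proj_s,
      stereo_coord (collapse_ne_pole_neg_one hw_norm)]
  · rw [f.discLift_of_ne_zero hw, ξ.proj_act, f.proj_s,
      stereo_coord (by simpa only [neg_neg] using collapse_ne_pole_one hw)]

theorem discLift_discBoundary (z : Circle) : f.discLift (discBoundary z) =
    ξ.act (f.s (-1) 0) (γ (-1) (rot z) * (γ 1 (rot z))⁻¹) := by
  rw [discLift_of_ne_zero _ z.coe_ne_zero, collapse_of_norm_eq_one z.norm_coe, coord_pole]
  change ξ.act _ (γ (-1) (rot (ang (z : ℂ))) * (γ 1 (rot (ang (z : ℂ))))⁻¹) = _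
  rw [ang_coe_circle]

end Framing

theorem C_eq_psi [LieGroup 𝓘(ℝ, V) ∞ G] [CompleteSpace V] [ConnectedSpace G]
    {α β : SmoothHom V G}
    (h : J (Quotient.mk (isoSetoid V G) ξ) =
      (Quotient.mk (conjSetoid V G) α, Quotient.mk (conjSetoid V G) β)) :
    ξ.toPrincipalBundle.C = {psi α β} := by
  obtain ⟨f⟩ := nonempty_framing_of_J_eq (γ := repPair α β) h
  exact (ξ.subsingleton_boundary collapse).eq_singleton_of_mem ⟨f.s (-1) 0,
    ⟨f.discLift, f.continuous_discLift⟩, psiLoop α β, f.proj_discLift,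
    fun t => f.discLift_discBoundary (circleLoop t), rfl⟩

end EquivariantPrincipalBundle

end Boundary

/-! ### Clutching -/

section Gluing

variable {F : Type*} [NormedAddCommGroup F] [NormedSpace ℝ F] {H : Type*} [TopologicalSpace H]
  {I : ModelWithCorners ℝ F H} {M : Type*} [TopologicalSpace M] [ChartedSpace H M]
  {X : Type*} [TopologicalSpace X] {ι : Type*} (e : ι → OpenPartialHomeomorph X M)

variable (H) in
/-- The charted space structure obtained by composing the charts of `M` with a covering family of
open partial homeomorphisms to `M`. -/
@[reducible]
def gluedChartedSpace (hcov : ∀ p, ∃ i, p ∈ (e i).source) : ChartedSpace H X where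
  atlas := {φ | ∃ i, ∃ c ∈ atlas H M, φ = (e i).trans c}
  chartAt p := (e (hcov p).choose).trans (chartAt H (e (hcov p).choose p))
  mem_chart_source p := by simp [(hcov p).choose_spec]
  chart_mem_atlas p := ⟨_, _, chart_mem_atlas _ _, rfl⟩

variable [IsManifold I ∞ M]

theorem isManifold_glued (hcov : ∀ p, ∃ i, p ∈ (e i).source)
    (he : ∀ i j, ContMDiffOn I I ∞ ((e i).symm.trans (e j)) ((e i).symm.trans (e j)).source) :
    letI := gluedChartedSpace H e hcov
    IsManifold I ∞ X := by
  let _ := gluedChartedSpace H e hcov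
  refine { compatible := ?_ }
  rintro _ _ ⟨i, c, hc, rfl⟩ ⟨j, c', hc', rfl⟩
  have hsymm : ((e i).symm.trans (e j)).symm = (e j).symm.trans (e i) := by
    rw [OpenPartialHomeomorph.trans_symm_eq_symm_trans_symm, OpenPartialHomeomorph.symm_symm]
  have hmax : ((e i).symm.trans (e j)).trans c' ∈ IsManifold.maximalAtlas I ∞ M := by
    apply OpenPartialHomeomorph.mem_maximalAtlas_of_contMDiffOn
    · refine (contMDiffOn_of_mem_maximalAtlas (IsManifold.subset_maximalAtlas hc')).comp
        ((he i j).mono fun x hx => ?_) fun x hx => ?_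
      · rw [OpenPartialHomeomorph.trans_source] at hx; exact hx.1
      · rw [OpenPartialHomeomorph.trans_source] at hx; exact hx.2
    · rw [OpenPartialHomeomorph.trans_symm_eq_symm_trans_symm, hsymm]
      refine (he j i).comp ((contMDiffOn_symm_of_mem_maximalAtlas
        (IsManifold.subset_maximalAtlas hc')).mono fun x hx => ?_) fun x hx => ?_
      · rw [OpenPartialHomeomorph.trans_target] at hx; exact hx.1
      · rw [OpenPartialHomeomorph.trans_target] at hx
        rw [← hsymm]; exact hx.2
  simpa only [OpenPartialHomeomorph.trans_symm_eq_symm_trans_symm,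
    OpenPartialHomeomorph.trans_assoc] using IsManifold.compatible_of_mem_maximalAtlas
      (IsManifold.subset_maximalAtlas (I := I) (n := ∞) hc) hmax

theorem contMDiffOn_glued (hcov : ∀ p, ∃ i, p ∈ (e i).source)
    (he : ∀ i j, ContMDiffOn I I ∞ ((e i).symm.trans (e j)) ((e i).symm.trans (e j)).source)
    (i : ι) :
    letI := gluedChartedSpace H e hcov
    ContMDiffOn I I ∞ (e i) (e i).source := by
  let _ := gluedChartedSpace H e hcov
  have := isManifold_glued e hcov he
  intro p hp
  let c := chartAt H (e i p)
  have hc : c ∈ atlas H M := chart_mem_atlas _ _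
  have hec : ContMDiffOn I I ∞ ((e i).trans c) ((e i).trans c).source :=
    contMDiffOn_of_mem_maximalAtlas (IsManifold.subset_maximalAtlas ⟨i, c, hc, rfl⟩)
  have hc_symm : ContMDiffOn I I ∞ c.symm c.target :=
    contMDiffOn_symm_of_mem_maximalAtlas (IsManifold.subset_maximalAtlas hc)
  have hp' : p ∈ ((e i).trans c).source := by simp [c, hp]
  refine (((hc_symm.comp hec fun x hx => c.map_source hx.2).congr fun x hx => ?_).contMDiffAt
    (((e i).trans c).open_source.mem_nhds hp')).contMDiffWithinAt
  exact (c.left_inv hx.2).symm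

theorem contMDiffOn_glued_symm (hcov : ∀ p, ∃ i, p ∈ (e i).source)
    (he : ∀ i j, ContMDiffOn I I ∞ ((e i).symm.trans (e j)) ((e i).symm.trans (e j)).source)
    (i : ι) :
    letI := gluedChartedSpace H e hcov
    ContMDiffOn I I ∞ (e i).symm (e i).target := by
  let _ := gluedChartedSpace H e hcov
  have := isManifold_glued e hcov he
  intro p hp
  let c := chartAt H p
  have hc : c ∈ atlas H M := chart_mem_atlas _ _
  have hec_symm : ContMDiffOn I I ∞ ((e i).trans c).symm ((e i).trans c).target :=
    contMDiffOn_symm_of_mem_maximalAtlas (IsManifold.subset_maximalAtlas ⟨i, c, hc, rfl⟩)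
  have hc_smooth : ContMDiffOn I I ∞ c c.source :=
    contMDiffOn_of_mem_maximalAtlas (IsManifold.subset_maximalAtlas hc)
  have hU : IsOpen (c.source ∩ (e i).target) := c.open_source.inter (e i).open_target
  have hcomp : ContMDiffOn I I ∞ (((e i).trans c).symm ∘ c) (c.source ∩ (e i).target) := by
    refine hec_symm.comp (hc_smooth.mono inter_subset_left) fun x hx => ?_
    rw [OpenPartialHomeomorph.trans_target]
    refine ⟨c.map_source hx.1, ?_⟩
    rw [mem_preimage, c.left_inv hx.1]
    exact hx.2
  refine ((hcomp.congr fun x hx => ?_).contMDiffAt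
    (hU.mem_nhds ⟨mem_chart_source _ _, hp⟩)).contMDiffWithinAt
  simp [c.left_inv hx.1]

theorem secondCountableTopology_glued [Countable ι] [SecondCountableTopology M]
    (hcov : ∀ p, ∃ i, p ∈ (e i).source) :
    SecondCountableTopology X := by
  have : ∀ i, SecondCountableTopology (e i).source := fun i =>
    (e i).toHomeomorphSourceTarget.secondCountableTopology
  exact TopologicalSpace.secondCountableTopology_of_countable_cover
    (fun i => (e i).open_source) (iUnion_eq_univ_iff.2 hcov)

end Gluing

/-- The first two coordinates of a point of the sphere, as a complex number. -/
def planar (x : S2) : ℂ := ⟨x.1 0, x.1 1⟩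

theorem contMDiff_planar : ContMDiff (𝓡 2) 𝓘(ℝ, ℂ) ∞ planar :=
  (Complex.equivRealProdCLM.symm.contDiff (n := ∞)).contMDiff.comp
    ((contMDiff_S2_coord 0).prodMk_space (contMDiff_S2_coord 1))

theorem planar_ne_zero {x : S2} (h_north : x ≠ pole 1) (h_south : x ≠ pole (-1)) :
    planar x ≠ 0 := by
  intro h
  have hre : x.1 0 = 0 := congrArg Complex.re h
  have him : x.1 1 = 0 := congrArg Complex.im h
  rw [Ne, eq_pole_iff, sgn_one] at h_north
  rw [Ne, eq_pole_iff, sgn_neg, sgn_one] at h_south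
  have hsq : x.1 2 ^ 2 = 1 := by simpa [hre, him] using x.sq_sum
  exact (sq_eq_one_iff.1 hsq).elim h_north h_south

theorem planar_rotate (z : Circle) (x : S2) : planar (rotate (rot z) x) = z * planar x := by
  apply Complex.ext <;> simp [planar, rotate, rot] <;> ring

/-- The rotation carrying a meridian to the one through a given point. -/
def angle (x : S2) : SO2 := rot (ang (planar x))

theorem contMDiffOn_angle : ContMDiffOn (𝓡 2) (𝓡 1) ∞ angle {x | planar x ≠ 0} :=
  contMDiff_rot.comp_contMDiffOn
    (contMDiffOn_ang.comp contMDiff_planar.contMDiffOn fun _ hx => hx)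

theorem angle_rotate (A : SO2) {x : S2} (hx : planar x ≠ 0) :
    angle (rotate A x) = A * angle x := by
  obtain ⟨z, rfl⟩ := rot_surjective A
  rw [angle, angle, planar_rotate, ang_circle_mul z hx, rot_mul]

theorem rotate_eq_pole_iff (A : SO2) (x : S2) (ε : ℤˣ) : rotate A x = pole ε ↔ x = pole ε := by
  rw [eq_pole_iff, eq_pole_iff]
  rfl

section Clutching

variable {V : Type v} [NormedAddCommGroup V] [NormedSpace ℝ V]
  {G : Type u} [Group G] [TopologicalSpace G] [ChartedSpace V G]

namespace Clutching

variable (γ : ℤˣ → SmoothHom V G)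

/-- The transition function of the clutching construction, from the trivialization with isotropy
representation `γ i` to the one with `γ j`. -/
def trans (i j : ℤˣ) (x : S2) : G := γ j (angle x) * (γ i (angle x))⁻¹

theorem trans_self (i : ℤˣ) (x : S2) : trans γ i i x = 1 := mul_inv_cancel _

theorem trans_mul (i j k : ℤˣ) (x : S2) : trans γ j k x * trans γ i j x = trans γ i k x := by
  simp [trans]

theorem planar_ne_zero_of_ne {i j : ℤˣ} (hij : i ≠ j) {x : S2}
    (hx : x ∈ ({pole (-i)}ᶜ ∩ {pole (-j)}ᶜ : Set S2)) : planar x ≠ 0 := by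
  rcases Int.units_eq_one_or i with rfl | rfl <;> rcases Int.units_eq_one_or j with rfl | rfl
  · exact absurd rfl hij
  · exact planar_ne_zero (by simpa using hx.2) (by simpa using hx.1)
  · exact planar_ne_zero (by simpa using hx.1) (by simpa using hx.2)
  · exact absurd rfl hij

theorem trans_rotate (i j : ℤˣ) (A : SO2) {x : S2}
    (hx : x ∈ ({pole (-i)}ᶜ ∩ {pole (-j)}ᶜ : Set S2)) :
    trans γ i j (rotate A x) * γ i A = γ j A * trans γ i j x := by
  by_cases hij : i = j
  · subst hij
    simp [trans_self]
  · rw [trans, trans, angle_rotate A (planar_ne_zero_of_ne hij hx), map_mul, map_mul]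
    group

variable [LieGroup 𝓘(ℝ, V) ∞ G]

theorem contMDiffOn_trans (i j : ℤˣ) :
    ContMDiffOn (𝓡 2) 𝓘(ℝ, V) ∞ (trans γ i j) ({pole (-i)}ᶜ ∩ {pole (-j)}ᶜ) := by
  by_cases hij : i = j
  · subst hij
    exact contMDiffOn_const.congr fun x _ => trans_self γ i x
  · have h : ContMDiffOn (𝓡 2) (𝓡 1) ∞ angle ({pole (-i)}ᶜ ∩ {pole (-j)}ᶜ) :=
      contMDiffOn_angle.mono fun x hx => planar_ne_zero_of_ne hij hx
    exact ((γ j).contMDiff_toFun.comp_contMDiffOn h).mul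
      ((γ i).contMDiff_toFun.comp_contMDiffOn h).inv

theorem contMDiffOn_coordChange (i j : ℤˣ) :
    ContMDiffOn ((𝓡 2).prod 𝓘(ℝ, V)) 𝓘(ℝ, V) ∞ (fun q : S2 × G => trans γ i j q.1 * q.2)
      (({pole (-i)}ᶜ ∩ {pole (-j)}ᶜ) ×ˢ univ) :=
  ((contMDiffOn_trans γ i j).comp contMDiff_fst.contMDiffOn fun _ hq => hq.1).mul
    contMDiff_snd.contMDiffOn

open Classical in
/-- The fibre bundle over the sphere glued by the transition functions. -/
def core : FiberBundleCore ℤˣ S2 G where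
  baseSet i := {pole (-i)}ᶜ
  isOpen_baseSet _ := isOpen_compl_singleton
  indexAt x := if x = pole 1 then 1 else -1
  mem_baseSet_at x := by
    by_cases h : x = pole 1
    · rw [if_pos h, h]; exact pole_ne_pole_neg 1
    · rw [if_neg h, neg_neg]; exact h
  coordChange i j x g := trans γ i j x * g
  coordChange_self i x _ g := by rw [trans_self, one_mul]
  continuousOn_coordChange i j := (contMDiffOn_coordChange γ i j).continuousOn
  coordChange_comp i j k x _ g := by rw [← mul_assoc, trans_mul]

/-- The total space of the clutching construction. -/
abbrev Total : Type u := (core γ).TotalSpace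

/-- The fibre coordinate of a point of the total space in the preferred trivialization at its base
point. -/
def fib (p : Total γ) : G := p.2

/-- The point of the total space with given base point and preferred fibre coordinate. -/
def mk (x : S2) (g : G) : Total γ := ⟨x, g⟩

variable {γ} in
theorem Total.ext {p q : Total γ} (hbase : p.1 = q.1) (hfib : fib γ p = fib γ q) : p = q := by
  obtain ⟨x, g⟩ := p
  obtain ⟨y, h⟩ := q
  obtain rfl : x = y := hbase
  obtain rfl : g = h := hfib
  rfl

/-- The trivializations of the clutching construction. -/
def triv (i : ℤˣ) : Bundle.Trivialization G (core γ).proj := (core γ).localTriv i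

/-- The trivialization `triv γ i` as a chart of the total space. -/
abbrev chart (i : ℤˣ) : OpenPartialHomeomorph (Total γ) (S2 × G) :=
  (triv γ i).toOpenPartialHomeomorph

theorem mem_triv_source {i : ℤˣ} {p : Total γ} :
    p ∈ (triv γ i).source ↔ p.1 ∈ ({pole (-i)}ᶜ : Set S2) := Iff.rfl

theorem exists_mem_triv_source (p : Total γ) :
    ∃ i, p ∈ (chart γ i).source := by
  obtain ⟨i, hi⟩ := exists_ne_pole_neg p.1
  exact ⟨i, hi⟩

theorem triv_change (i j : ℤˣ) {q : S2 × G}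
    (hq : q ∈ ((chart γ i).symm.trans (chart γ j)).source) :
    q.1 ∈ ({pole (-i)}ᶜ ∩ {pole (-j)}ᶜ : Set S2) ∧
    (chart γ i).symm.trans (chart γ j) q =
      (q.1, trans γ i j q.1 * q.2) := by
  rw [OpenPartialHomeomorph.trans_source] at hq
  refine ⟨⟨hq.1.1, hq.2⟩, Prod.ext rfl ?_⟩
  change trans γ ((core γ).indexAt q.1) j q.1 * (trans γ i ((core γ).indexAt q.1) q.1 * q.2) =
    trans γ i j q.1 * q.2
  rw [← mul_assoc, trans_mul]

theorem contMDiffOn_triv_change (i j : ℤˣ) :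
    ContMDiffOn ((𝓡 2).prod 𝓘(ℝ, V)) ((𝓡 2).prod 𝓘(ℝ, V)) ∞
      ((chart γ i).symm.trans (chart γ j))
      ((chart γ i).symm.trans (chart γ j)).source := by
  have h : ContMDiffOn ((𝓡 2).prod 𝓘(ℝ, V)) ((𝓡 2).prod 𝓘(ℝ, V)) ∞
      (fun q : S2 × G => (q.1, trans γ i j q.1 * q.2)) (({pole (-i)}ᶜ ∩ {pole (-j)}ᶜ) ×ˢ univ) :=
    contMDiff_fst.contMDiffOn.prodMk (contMDiffOn_coordChange γ i j)
  exact (h.mono fun q hq => ⟨(triv_change γ i j hq).1, mem_univ _⟩).congr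
    fun q hq => (triv_change γ i j hq).2

instance : ChartedSpace (ModelProd (EuclideanSpace ℝ (Fin 2)) V) (Total γ) :=
  gluedChartedSpace _ (chart γ) (exists_mem_triv_source γ)

instance : IsManifold (totalModel V) ∞ (Total γ) :=
  isManifold_glued (chart γ) (exists_mem_triv_source γ)
    (contMDiffOn_triv_change γ)

theorem contMDiffOn_triv (i : ℤˣ) :
    ContMDiffOn (totalModel V) ((𝓡 2).prod 𝓘(ℝ, V)) ∞ (triv γ i) (triv γ i).source :=
  contMDiffOn_glued (chart γ) (exists_mem_triv_source γ)
    (contMDiffOn_triv_change γ) i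

theorem contMDiffOn_triv_symm (i : ℤˣ) :
    ContMDiffOn ((𝓡 2).prod 𝓘(ℝ, V)) (totalModel V) ∞ (chart γ i).symm
      (triv γ i).target :=
  contMDiffOn_glued_symm (chart γ) (exists_mem_triv_source γ)
    (contMDiffOn_triv_change γ) i

instance [SecondCountableTopology G] : SecondCountableTopology (Total γ) :=
  secondCountableTopology_glued (chart γ)
    (exists_mem_triv_source γ)

instance [T2Space G] : T2Space (Total γ) := by
  refine ⟨fun p q hpq => ?_⟩
  by_cases h : p.1 = q.1
  · obtain ⟨i, hi⟩ := exists_ne_pole_neg p.1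
    have hp : p ∈ (triv γ i).source := hi
    have hq : q ∈ (triv γ i).source := by rw [mem_triv_source, ← h]; exact hi
    obtain ⟨A, B, hA, hB, hpA, hqB, hAB⟩ := t2_separation ((triv γ i).injOn.ne hp hq hpq)
    exact ⟨_, _, (chart γ i).isOpen_inter_preimage hA,
      (chart γ i).isOpen_inter_preimage hB, ⟨hp, hpA⟩, ⟨hq, hqB⟩,
      (hAB.preimage _).mono inter_subset_right inter_subset_right⟩
  · obtain ⟨A, B, hA, hB, hpA, hqB, hAB⟩ := t2_separation h
    exact ⟨_, _, hA.preimage (core γ).continuous_proj, hB.preimage (core γ).continuous_proj,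
      hpA, hqB, hAB.preimage _⟩

/-- The right action of `G` on the total space of the clutching construction. -/
def act (p : Total γ) (g : G) : Total γ := mk γ p.1 (fib γ p * g)

/-- The left action of `SO(2)`, written in the preferred fibre coordinates: the index of the
preferred trivialization is constant along the orbits of `SO(2)` on the sphere. -/
def rotAct (A : SO2) (p : Total γ) : Total γ :=
  mk γ (rotate A p.1) (γ ((core γ).indexAt p.1) A * fib γ p)

theorem indexAt_rotate (A : SO2) (x : S2) :
    (core γ).indexAt (rotate A x) = (core γ).indexAt x := by
  simp only [core, rotate_eq_pole_iff]

theorem triv_act (i : ℤˣ) (p : Total γ) (g : G) :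
    triv γ i (act γ p g) = ((triv γ i p).1, (triv γ i p).2 * g) :=
  Prod.ext rfl (mul_assoc _ _ _).symm

theorem triv_rotAct (i : ℤˣ) (A : SO2) {p : Total γ} (hp : p ∈ (triv γ i).source) :
    triv γ i (rotAct γ A p) = (rotate A (triv γ i p).1, γ i A * (triv γ i p).2) := by
  refine Prod.ext rfl ?_
  change trans γ ((core γ).indexAt (rotate A p.1)) i (rotate A p.1) *
    (γ ((core γ).indexAt p.1) A * fib γ p) =
      γ i A * (trans γ ((core γ).indexAt p.1) i p.1 * fib γ p)
  rw [indexAt_rotate, ← mul_assoc, ← mul_assoc,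
    trans_rotate γ _ _ A ⟨(core γ).mem_baseSet_at p.1, hp⟩]

theorem contMDiffAt_of_triv {F : Type*} [NormedAddCommGroup F] [NormedSpace ℝ F] {H : Type*}
    [TopologicalSpace H] {I : ModelWithCorners ℝ F H} {M : Type*} [TopologicalSpace M]
    [ChartedSpace H M] (i : ℤˣ) {f : M → Total γ} {U : Set M} {q : M} (hU : U ∈ 𝓝 q)
    (hfU : MapsTo f U (triv γ i).source)
    (hf : ContMDiffOn I ((𝓡 2).prod 𝓘(ℝ, V)) ∞ (fun x => triv γ i (f x)) U) :
    ContMDiffAt I (totalModel V) ∞ f q :=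
  (((contMDiffOn_triv_symm γ i).comp hf fun _ hx => (triv γ i).map_source (hfU hx)).congr
    fun _ hx => ((triv γ i).left_inv (hfU hx)).symm).contMDiffAt hU

theorem contMDiff_act : ContMDiff ((totalModel V).prod 𝓘(ℝ, V)) (totalModel V) ∞
    fun q : Total γ × G => act γ q.1 q.2 := by
  rintro ⟨p, g⟩
  obtain ⟨i, hi⟩ := exists_mem_triv_source γ p
  let U : Set (Total γ × G) := (triv γ i).source ×ˢ univ
  have hU : IsOpen U := (triv γ i).open_source.prod isOpen_univ
  have htriv : ContMDiffOn ((totalModel V).prod 𝓘(ℝ, V)) ((𝓡 2).prod 𝓘(ℝ, V)) ∞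
      (fun q : Total γ × G => triv γ i q.1) U :=
    (contMDiffOn_triv γ i).comp contMDiff_fst.contMDiffOn fun q hq => hq.1
  refine contMDiffAt_of_triv γ i (hU.mem_nhds ⟨hi, mem_univ g⟩) (fun q hq => hq.1) ?_
  exact ((contMDiff_fst.comp_contMDiffOn htriv).prodMk
    ((contMDiff_snd.comp_contMDiffOn htriv).mul contMDiff_snd.contMDiffOn)).congr
      fun q _ => triv_act γ i q.1 q.2

theorem contMDiff_rotAct : ContMDiff ((𝓡 1).prod (totalModel V)) (totalModel V) ∞
    fun q : SO2 × Total γ => rotAct γ q.1 q.2 := by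
  rintro ⟨A, p⟩
  obtain ⟨i, hi⟩ := exists_mem_triv_source γ p
  let U : Set (SO2 × Total γ) := univ ×ˢ (triv γ i).source
  have hU : IsOpen U := isOpen_univ.prod (triv γ i).open_source
  have htriv : ContMDiffOn ((𝓡 1).prod (totalModel V)) ((𝓡 2).prod 𝓘(ℝ, V)) ∞
      (fun q : SO2 × Total γ => triv γ i q.2) U :=
    (contMDiffOn_triv γ i).comp contMDiff_snd.contMDiffOn fun q hq => hq.2
  have hA : ContMDiffOn ((𝓡 1).prod (totalModel V)) (𝓡 1) ∞ (fun q : SO2 × Total γ => q.1) U :=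
    contMDiff_fst.contMDiffOn
  have hmaps : MapsTo (fun q : SO2 × Total γ => rotAct γ q.1 q.2) U (triv γ i).source :=
    fun q hq => (rotate_eq_pole_iff q.1 q.2.1 (-i)).not.2 hq.2
  refine contMDiffAt_of_triv γ i (hU.mem_nhds ⟨mem_univ A, hi⟩) hmaps ?_
  exact ((contMDiff_rotate.comp_contMDiffOn
    (hA.prodMk (contMDiff_fst.comp_contMDiffOn htriv))).prodMk
      (((γ i).contMDiff_toFun.comp_contMDiffOn hA).mul
        (contMDiff_snd.comp_contMDiffOn htriv))).congr fun q hq => triv_rotAct γ i q.1 hq.2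

theorem contMDiff_proj : ContMDiff (totalModel V) (𝓡 2) ∞ (core γ).proj := by
  intro p
  obtain ⟨i, hi⟩ := exists_mem_triv_source γ p
  exact (contMDiff_fst.comp_contMDiffOn (contMDiffOn_triv γ i)).contMDiffAt
    ((triv γ i).open_source.mem_nhds hi)

/-- The equivariant bundle with isotropy representation `γ ε` at the pole `ε`. -/
def bundle [T2Space G] [SecondCountableTopology G] : EquivariantPrincipalBundle V G where
  E := Total γ
  proj := (core γ).proj
  proj_smooth := contMDiff_proj γ
  act := act γ
  act_one p := Total.ext rfl (mul_one _)
  act_mul p g h := Total.ext rfl (mul_assoc _ _ _).symm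
  act_free p g h := mul_eq_left.1 (congrArg (fib γ) h)
  act_smooth := contMDiff_act γ
  proj_act _ _ := rfl
  locally_trivial x := by
    obtain ⟨i, hi⟩ := exists_ne_pole_neg x
    exact ⟨triv γ i, hi, contMDiffOn_triv γ i, contMDiffOn_triv_symm γ i,
      fun p _ g => triv_act γ i p g⟩
  rotAct := rotAct γ
  rotAct_one p := by
    refine Total.ext (rotate_one _) ?_
    change γ _ 1 * fib γ p = fib γ p
    rw [map_one, one_mul]
  rotAct_mul A B p := by
    refine Total.ext (rotate_mul _ _ _) ?_
    change γ _ (A * B) * fib γ p =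
      γ ((core γ).indexAt (rotate B p.1)) A * (γ ((core γ).indexAt p.1) B * fib γ p)
    rw [indexAt_rotate, map_mul, mul_assoc]
  rotAct_smooth := contMDiff_rotAct γ
  rotAct_act A p g := Total.ext rfl (mul_assoc _ _ _).symm
  proj_rotAct _ _ := rfl

theorem bundle_isotropyClass [T2Space G] [SecondCountableTopology G] {x : S2}
    (hx : ∀ A, rotate A x = x) (i : ℤˣ) (hxi : x = pole i) :
    (bundle γ).isotropyClass x hx = Quotient.mk _ (γ i) := by
  have hmem : x ∈ (triv γ i).baseSet := by rw [hxi]; exact pole_ne_pole_neg i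
  have hmem' : (x, (1 : G)) ∈ (triv γ i).target := (triv γ i).mem_target.2 hmem
  let a : Total γ := (chart γ i).symm (x, 1)
  have ha : triv γ i a = (x, 1) := (triv γ i).right_inv hmem'
  have ha_mem : a ∈ (triv γ i).source := (triv γ i).map_target hmem'
  refine (bundle γ).isotropyClass_eq x hx a rfl (γ i) fun A => ?_
  have hrot_mem : rotAct γ A a ∈ (triv γ i).source :=
    (mem_triv_source γ).2 (mem_of_eq_of_mem (hx A) hmem)
  have htriv : triv γ i (rotAct γ A a) = triv γ i (act γ a (γ i A)) := by
    rw [triv_rotAct γ i A ha_mem, triv_act, ha, hx, mul_one, one_mul]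
  exact (chart γ i).injOn hrot_mem ha_mem htriv

end Clutching

theorem J_surjective [LieGroup 𝓘(ℝ, V) ∞ G] [T2Space G] [SecondCountableTopology G] :
    Function.Surjective (J (V := V) (G := G)) := by
  rintro ⟨c, d⟩
  induction c using Quotient.inductionOn with | _ α
  induction d using Quotient.inductionOn with | _ β
  exact ⟨Quotient.mk _ (Clutching.bundle (repPair α β)), Prod.ext
    (Clutching.bundle_isotropyClass _ rotate_southPole (-1) pole_neg_one.symm)
    (Clutching.bundle_isotropyClass _ rotate_northPole 1 pole_one.symm)⟩

end Clutching

end EquivariantBundle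

end

theorem theoremA_general {V : Type*} [NormedAddCommGroup V] [NormedSpace ℝ V] [CompleteSpace V]
    {G : Type*} [Group G] [TopologicalSpace G] [ChartedSpace V G] [LieGroup 𝓘(ℝ, V) ∞ G]
    [T2Space G] [SecondCountableTopology G] [ConnectedSpace G] :
    Function.Bijective (EquivariantBundle.J (V := V) (G := G)) ∧
    ∀ (ξ : EquivariantBundle.EquivariantPrincipalBundle V G)
      (α β : EquivariantBundle.SmoothHom V G),
      EquivariantBundle.J (Quotient.mk (EquivariantBundle.isoSetoid V G) ξ) =
        (Quotient.mk (EquivariantBundle.conjSetoid V G) α,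
          Quotient.mk (EquivariantBundle.conjSetoid V G) β) →
      ξ.toPrincipalBundle.C = {EquivariantBundle.psi α β} :=
  ⟨⟨EquivariantBundle.J_injective, EquivariantBundle.J_surjective⟩,
    fun _ _ _ h => EquivariantBundle.EquivariantPrincipalBundle.C_eq_psi h⟩

/-- Let `G` be a connected Lie group. Then `J` is a bijection from the set of isomorphism classes of
`SO(2)`-equivariant principal `G`-bundles over `S²` onto the set of pairs of conjugacy classes of
smooth homomorphisms `SO(2) → G`; and if `J(ξ) = ([α], [β])`, then the class `C(ξ♭) ∈ π₁(G)` of the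
underlying non-equivariant bundle is `ψ(α, β)`. -/
theorem theoremA {V : Type*} [NormedAddCommGroup V] [NormedSpace ℝ V] [FiniteDimensional ℝ V]
    {G : Type*} [Group G] [TopologicalSpace G] [ChartedSpace V G] [LieGroup 𝓘(ℝ, V) ∞ G]
    [T2Space G] [SecondCountableTopology G] [ConnectedSpace G] :
    Function.Bijective (EquivariantBundle.J (V := V) (G := G)) ∧
    ∀ (ξ : EquivariantBundle.EquivariantPrincipalBundle V G)
      (α β : EquivariantBundle.SmoothHom V G),
      EquivariantBundle.J (Quotient.mk (EquivariantBundle.isoSetoid V G) ξ) =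
        (Quotient.mk (EquivariantBundle.conjSetoid V G) α,
          Quotient.mk (EquivariantBundle.conjSetoid V G) β) →
      ξ.toPrincipalBundle.C = {EquivariantBundle.psi α β} :=
  have := FiniteDimensional.complete ℝ V
  theoremA_general
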